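/- Let $d\ge 1$, let $\|\cdot\|$ and $\langle u,v\rangle=\int_{\mathbb R^d}u\,\overline v\,dx$ be the norm and inner product of $L^2(\mathbb R^d,\mathbb C)$, and let $(\mathcal Bu)(x)=\overline{u(-x)}$. Consider $$A\varphi-W(x,\omega)\varphi=f(x,\omega,\varphi),\qquad x\in\mathbb R^d,\tag{1}$$ and put $L(\omega)=A-W(\cdot,\omega)$ on $D(A)$ and $\|u\|_A=\|u\|+\|Au\|$. Balls in $D(A)$ are taken in $\|\cdot\|_A$. Let $\omega_0\in\mathbb R$, $\delta,\alpha,\beta,\lambda_0>0$, $\tau\in(0,\min\{1,\alpha\beta\}]$, and assume: * (A) $A:D(A)\to L^2(\mathbb R^d,\mathbb C)$ is densely defined and closed with non-empty resolvent set, and $D(A)\hookrightarrow L^\infty(\mathbb R^d,\mathbb C)$ continuously. * (W) $W(x,\cdot)$ is holomorphic on $B_\delta(\omega_0)\subset\mathbb C$ for a.e. $x$, and $\sup_{\omega\in B_\delta(\omega_0)}\|W(\cdot,\omega)\|_\infty<\infty$. * $\omega_0$ is an algebraically simple eigenvalue, $\ker L(\omega_0)^2=\ker L(\omega_0)=\langle\varphi_0\rangle$,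 and $L(\omega_0)$ has closed range. It is isolated: there is $\rho>0$ such that, for $\omega\in B_\rho(\omega_0)$, $0\in\sigma(L(\omega))$ if and only if $\omega=\omega_0$. Moreover $\varphi_0^*\in\ker L(\omega_0)^*$, $\|\varphi_0\|=1$, $\langle\varphi_0,\varphi_0^*\rangle=1$, and $\langle\partial_\omega W(\cdot,\omega_0)\varphi_0,\varphi_0^*\rangle\ne0$. * (f) $f(\cdot,\omega,\varphi(\cdot))\in L^2$ for all $\omega\in B_\delta(\omega_0)$ and $\varphi\in B_\delta(0)\subset D(A)$; there is $K$ such that for all $\lambda\in(0,\lambda_0)$, $\omega,\omega_1,\omega_2\in B_\delta(\omega_0)$ and $\varphi,\varphi_1,\varphi_2\in B_\delta(\varphi_0)\subset D(A)$ $$\|f(\cdot,\omega_1,\lambda\varphi)-f(\cdot,\omega_2,\lambda\varphi)\|\le K\lambda^{\frac1\alpha+1}|\omega_1-\omega_2|,\qquad \|f(\cdot,\omega,\lambda\varphi_1)-f(\cdot,\omega,\lambda\varphi_2)\|\le K\lambda^{\frac1\alpha+1}\|\varphi_1-\varphi_2\|;$$ and there are $g_\omega\in L^\infty(\mathbb R^d,\mathbb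 C)\setminus\{0\}$, $\omega\in B_\delta(\omega_0)$, with $\|g_{\omega_1}-g_{\omega_2}\|_\infty\le K_g|\omega_1-\omega_2|$ for a constant $K_g$, such that $f(x,\omega,z)-g_\omega(x)|z|^{\frac1\alpha}z=O(|z|^{\frac1\alpha+1+\beta})$ as $\mathbb C\ni z\to0$, uniformly in $\omega\in B_\delta(\omega_0)$ and a.e. $x$. * ($\mathcal{PT}$) $\mathcal B D(A)\subset D(A)$ and $A\mathcal B=\mathcal BA$ on $D(A)$; and for all real $\omega\in B_\delta(\omega_0)$: $\mathcal BW(\cdot,\omega)=W(\cdot,\omega)$, $\mathcal Bg_\omega=g_\omega$, and $f(\cdot,\omega,\mathcal B\varphi)=\mathcal B\big(f(\cdot,\omega,\varphi)\big)$ for all $\varphi\in B_\delta(0)\subset D(A)$. Then $\mathcal B(c\varphi_0)=c\varphi_0$ for some $c\in\mathbb C$ with $|c|=1$, so the normalized eigenfunction can be chosen $\mathcal{PT}$-symmetric. If $\mathcal B\varphi_0=\varphi_0$, then there are $\varepsilon_0,\eta,r>0$, $\nu\in\mathbb C$ and $\phi\in D(A)\cap\langle\varphi_0^*\rangle^\perp$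 such that for every $\varepsilon\in(0,\varepsilon_0)$ the equation (1) with the constraint $\langle\varphi,\varphi_0^*\rangle=\varepsilon^\alpha$ has exactly one solution $(\omega,\varphi)\in\mathbb C\times D(A)$ with $|\omega-\omega_0|<\eta$ and $\|\varphi-\varepsilon^\alpha\varphi_0\|_A<\eta\,\varepsilon^\alpha$; it has the form $$\omega=\omega_0+\varepsilon\nu+\varepsilon^{1+\tau}\sigma,\qquad \varphi=\varepsilon^\alpha\varphi_0+\varepsilon^{\alpha+1}\phi+\varepsilon^{\alpha+1+\tau}\psi$$ with some $\sigma\in\mathbb C$, $\psi\in D(A)\cap\langle\varphi_0^*\rangle^\perp$ (depending on $\varepsilon$), $|\sigma|\le r$, $\|\psi\|_A\le r$; and it satisfies $\omega\in\mathbb R$ and $\mathcal B\varphi=\varphi$. -/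

import Mathlib

open MeasureTheory Set
open scoped ENNReal ComplexConjugate

noncomputable section

namespace PTBif

/-- The Euclidean space `ℝ^d`. -/
abbrev Rd (d : ℕ) : Type := EuclideanSpace ℝ (Fin d)

/-- The complex Hilbert space `L²(ℝ^d, ℂ)`. -/
abbrev L2 (d : ℕ) : Type := Lp ℂ 2 (volume : Measure (Rd d))

/-- A (possibly unbounded) linear operator in `L²(ℝ^d, ℂ)` with its domain. -/
abbrev Op (d : ℕ) : Type := L2 d →ₗ.[ℂ] L2 d

variable {d : ℕ}

/-! ### The symmetry -/

/-- `(ℬ u)(x) = conj (u (-x))` on functions. -/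
def ptFun (u : Rd d → ℂ) : Rd d → ℂ := fun x => conj (u (-x))

theorem memLp_ptFun {u : Rd d → ℂ} {p : ℝ≥0∞} (hu : MemLp u p volume) :
    MemLp (ptFun u) p volume := by
  have h : MemLp (fun x => u (-x)) p volume :=
    hu.comp_measurePreserving (Measure.measurePreserving_neg volume)
  exact h.star

/-- `ℬ` on `L²(ℝ^d, ℂ)`. -/
def PT (u : L2 d) : L2 d := (memLp_ptFun (Lp.memLp u)).toLp _

theorem coeFn_PT (u : L2 d) : PT u =ᵐ[volume] fun x => conj (u (-x)) :=
  MemLp.coeFn_toLp _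

/-- A function is `PT`-symmetric if `ℬ w = w` (as an element of a Lebesgue space). -/
def PTFunction (w : Rd d → ℂ) : Prop := ∀ᵐ x, conj (w (-x)) = w x

/-- An operator is `PT`-symmetric if `ℬ` preserves its domain and commutes with it there. -/
def PTOperator (T : Op d) : Prop :=
  ∀ u : T.domain, ∃ h : PT (u : L2 d) ∈ T.domain, T ⟨PT u, h⟩ = PT (T u)

/-! ### Unbounded operators -/

/-- The graph norm `‖u‖_T = ‖u‖ + ‖T u‖` on the domain of `T`. -/
def graphNorm (T : Op d) (u : T.domain) : ℝ := ‖(u : L2 d)‖ + ‖T u‖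

/-- `z` is in the resolvent set of `T`: `z - T : D(T) → L²` has a bounded two-sided inverse. -/
def InResolventSet (T : Op d) (z : ℂ) : Prop :=
  ∃ R : L2 d →L[ℂ] L2 d,
    (∀ y, ∃ h : R y ∈ T.domain, z • R y - T ⟨R y, h⟩ = y) ∧
    ∀ u : T.domain, R (z • (u : L2 d) - T u) = u

/-- `z` is in the spectrum of `T`. -/
def InSpectrum (T : Op d) (z : ℂ) : Prop := ¬ InResolventSet T z

/-- Multiplication by a function `w ∈ L^∞` as an operator on `L²` (and `0` if `w ∉ L^∞`). -/
def mulOp (w : Rd d → ℂ) : L2 d →L[ℂ] L2 d :=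
  open Classical in
  if hw : MemLp w ∞ volume then
    (ContinuousLinearMap.mul ℂ ℂ).holderL volume ∞ 2 2 (hw.toLp w)
  else 0

theorem coeFn_mulOp {w : Rd d → ℂ} (hw : MemLp w ∞ volume) (u : L2 d) :
    mulOp w u =ᵐ[volume] fun x => w x * u x := by
  have h1 := (ContinuousLinearMap.mul ℂ ℂ).coeFn_holder (r := 2) (hw.toLp w) u
  have h2 := hw.coeFn_toLp
  rw [mulOp, dif_pos hw]
  filter_upwards [h1, h2] with x hx hx2
  rw [hx2] at hx
  exact hx

/-- `L(·, ω) = A - W(·, ω)` with domain `D(A)`. -/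
def opL (A : Op d) (W : Rd d → ℂ → ℂ) (ω : ℂ) : Op d where
  domain := A.domain
  toFun := A.toFun - (mulOp fun x => W x ω).toLinearMap ∘ₗ A.domain.subtype

/-! ### Assumptions on the linear problem -/

/-- `A` is densely defined and closed with non-empty resolvent set, and `D(A)` with the graph
norm embeds continuously into `L^∞`. -/
structure AssumptionA (A : Op d) : Prop where
  dense : Dense (A.domain : Set (L2 d))
  closed : A.IsClosed
  resolvent : ∃ z, InResolventSet A z
  embedding : ∃ C : ℝ, ∀ u : A.domain,
    eLpNorm (u : L2 d) ∞ volume ≤ ENNReal.ofReal (C * graphNorm A u)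

/-- `W(x, ·)` is holomorphic on `B_δ(ω₀)` for a.e. `x`, and `W(·, ω)` is bounded in `L^∞` uniformly
in `ω ∈ B_δ(ω₀)`. -/
structure AssumptionW (W : Rd d → ℂ → ℂ) (ω₀ : ℂ) (δ : ℝ) : Prop where
  holomorphic : ∀ᵐ x : Rd d, DifferentiableOn ℂ (W x) (Metric.ball ω₀ δ)
  bounded : ∃ c : ℝ, ∀ ω ∈ Metric.ball ω₀ δ, MemLp (fun x => W x ω) ∞ volume ∧
    eLpNorm (fun x => W x ω) ∞ volume ≤ ENNReal.ofReal c

/-- `ω₀` is an algebraically simple eigenvalue: `ker L(·, ω₀)² = ker L(·, ω₀) = ⟨φ₀⟩`, with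
`ran L(·, ω₀)` closed. -/
structure AlgebraicallySimple (A : Op d) (W : Rd d → ℂ → ℂ) (ω₀ : ℂ) (φ₀ : A.domain) : Prop where
  ker : ∀ u : (opL A W ω₀).domain, opL A W ω₀ u = 0 ↔ ∃ c : ℂ, (u : L2 d) = c • (φ₀ : L2 d)
  ker_sq : ∀ (u : (opL A W ω₀).domain) (h : opL A W ω₀ u ∈ (opL A W ω₀).domain),
    opL A W ω₀ ⟨opL A W ω₀ u, h⟩ = 0 → opL A W ω₀ u = 0
  closed_range : IsClosed (Set.range fun u : (opL A W ω₀).domain => opL A W ω₀ u)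

/-- `ω₀` is isolated: near `ω₀`, `0` is in the spectrum of `L(·, ω)` only for `ω = ω₀`. -/
def Isolated (A : Op d) (W : Rd d → ℂ → ℂ) (ω₀ : ℂ) : Prop :=
  ∃ ρ : ℝ, 0 < ρ ∧ ∀ ω ∈ Metric.ball ω₀ ρ, InSpectrum (opL A W ω) 0 ↔ ω = ω₀

/-- `φ₀` is normalized and `φs` is the eigenfunction of the Hilbert space adjoint of `L(·, ω₀)` with
`⟨φ₀, φs⟩ = 1`. (Mathlib's inner product is linear in its second argument.) -/
structure Normalized (A : Op d) (W : Rd d → ℂ → ℂ) (ω₀ : ℂ) (φ₀ : A.domain) (φs : L2 d) :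
    Prop where
  norm_one : ‖(φ₀ : L2 d)‖ = 1
  adjoint_ker : ∃ h : φs ∈ (opL A W ω₀).adjoint.domain, (opL A W ω₀).adjoint ⟨φs, h⟩ = 0
  inner_one : inner ℂ φs (φ₀ : L2 d) = 1

/-- `⟨∂_ω W(·, ω₀) φ₀, φs⟩ ≠ 0`. -/
def Transversal (W : Rd d → ℂ → ℂ) (ω₀ : ℂ) (φ₀ φs : L2 d) : Prop :=
  ∫ x, deriv (W x) ω₀ * φ₀ x * conj (φs x) ≠ 0

/-! ### Assumptions on the nonlinearity -/

/-- The assumptions on the nonlinearity `f(x, ω, φ)` and on its leading coefficient `g ω`. Balls in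
`D(A)` are taken in the graph norm. -/
structure AssumptionF (A : Op d) (ω₀ : ℂ) (φ₀ : A.domain) (δ α β : ℝ)
    (f : Rd d → ℂ → ℂ → ℂ) (g : ℂ → Rd d → ℂ) : Prop where
  memL2 : ∀ ω ∈ Metric.ball ω₀ δ, ∀ u : A.domain, graphNorm A u < δ →
    MemLp (fun x => f x ω ((u : L2 d) x)) 2 volume
  lipschitz : ∃ l₀ : ℝ, 0 < l₀ ∧ ∃ K : ℝ, ∀ l ∈ Ioo (0 : ℝ) l₀,
    (∀ ω₁ ∈ Metric.ball ω₀ δ, ∀ ω₂ ∈ Metric.ball ω₀ δ, ∀ u : A.domain, graphNorm A (u - φ₀) < δ →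
      eLpNorm (fun x => f x ω₁ ((l : ℂ) * (u : L2 d) x) - f x ω₂ ((l : ℂ) * (u : L2 d) x)) 2 volume
        ≤ ENNReal.ofReal (K * l ^ (1 / α + 1) * ‖ω₁ - ω₂‖)) ∧
    (∀ ω ∈ Metric.ball ω₀ δ, ∀ u₁ u₂ : A.domain,
      graphNorm A (u₁ - φ₀) < δ → graphNorm A (u₂ - φ₀) < δ →
      eLpNorm (fun x => f x ω ((l : ℂ) * (u₁ : L2 d) x) - f x ω ((l : ℂ) * (u₂ : L2 d) x)) 2 volume
        ≤ ENNReal.ofReal (K * l ^ (1 / α + 1) * ‖(u₁ : L2 d) - (u₂ : L2 d)‖))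
  g_mem : ∀ ω ∈ Metric.ball ω₀ δ, MemLp (g ω) ∞ volume ∧ ¬ (g ω =ᵐ[volume] 0)
  asymptotics : ∃ C : ℝ, ∃ s : ℝ, 0 < s ∧ ∀ ω ∈ Metric.ball ω₀ δ, ∀ᵐ x : Rd d, ∀ z : ℂ, ‖z‖ < s →
    ‖f x ω z - g ω x * ((‖z‖ ^ (1 / α) : ℝ) : ℂ) * z‖ ≤ C * ‖z‖ ^ (1 / α + 1 + β)
  g_lipschitz : ∃ K : ℝ, ∀ ω₁ ∈ Metric.ball ω₀ δ, ∀ ω₂ ∈ Metric.ball ω₀ δ,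
    eLpNorm (fun x => g ω₁ x - g ω₂ x) ∞ volume ≤ ENNReal.ofReal (K * ‖ω₁ - ω₂‖)

/-- `A`, `W(·, ω)`, `φ ↦ f(·, ω, φ)` (on the ball of `D(A)` where it maps into `L²`) and `g ω` are
`PT`-symmetric, for real `ω` near `ω₀`. -/
structure PTSymmetricProblem (A : Op d) (W : Rd d → ℂ → ℂ) (f : Rd d → ℂ → ℂ → ℂ)
    (g : ℂ → Rd d → ℂ) (ω₀ δ : ℝ) : Prop where
  opA : PTOperator A
  potential : ∀ ω : ℝ, |ω - ω₀| < δ → PTFunction fun x => W x ω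
  nonlinearity : ∀ ω : ℝ, |ω - ω₀| < δ → ∀ u : A.domain, graphNorm A u < δ →
    ∀ᵐ x, f x ω (PT (u : L2 d) x) = conj (f (-x) ω ((u : L2 d) (-x)))
  coefficient : ∀ ω : ℝ, |ω - ω₀| < δ → PTFunction (g ω)

/-! ### The nonlinear eigenvalue problem -/

/-- `A φ - W(x, ω) φ = f(x, ω, φ)` in `ℝ^d`. -/
def Solves (A : Op d) (W : Rd d → ℂ → ℂ) (f : Rd d → ℂ → ℂ → ℂ) (ω : ℂ) (φ : A.domain) : Prop :=
  ∀ᵐ x, A φ x - W x ω * (φ : L2 d) x = f x ω ((φ : L2 d) x)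

/-- `(ω, φ)` solves the problem with the constraint `⟨φ, φs⟩ = ε^α`, and is close to
`(ω₀, ε^α φ₀)`: `|ω - ω₀| < η` and `‖φ - ε^α φ₀‖_A < η ε^α`. -/
structure LocalSolution (A : Op d) (W : Rd d → ℂ → ℂ) (f : Rd d → ℂ → ℂ → ℂ) (ω₀ : ℂ)
    (φ₀ : A.domain) (φs : L2 d) (α η ε : ℝ) (ω : ℂ) (φ : A.domain) : Prop where
  solves : Solves A W f ω φ
  constraint : inner ℂ φs (φ : L2 d) = ((ε ^ α : ℝ) : ℂ)
  near_omega : ‖ω - ω₀‖ < η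
  near_phi : graphNorm A (φ - ((ε ^ α : ℝ) : ℂ) • φ₀) < η * ε ^ α

end PTBif

end

noncomputable section

namespace PTBif

variable {d : ℕ}

/-! ### The symmetry `ℬ` on `L²` -/

/-! The proof is a Lyapunov–Schmidt reduction solved by contraction. Write `φ = ε^α (φ₀ + u)` and `ω
= ω₀ + μ` with `u` orthogonal to `φs`. After division by `ε^α` the equation reads `L(ω₀) u - μ
∂_ωW(ω₀) φ₀ = N_ε(u, μ)`. Here `N_ε` collects the second order remainder of the potential and the
rescaled nonlinearity, which is Lipschitz of size `ε` because `(ε^α)^(1/α + 1) = ε^α ε`.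

The bordered map `(u, μ) ↦ (L(ω₀) u - μ ∂_ωW(ω₀) φ₀, ⟨u, φs⟩)` is an isomorphism
(`exists_bordered_equiv`). Pairing with `φs` removes `L(ω₀) u`, so transversality determines `μ`,
and the constraint removes the kernel `⟨φ₀⟩`. Surjectivity needs `ran L(ω₀) = φs^⊥`. This follows
from closed range and isolation: `L(ω₀)` is a limit of invertible operators, so its range cannot
have codimension larger than the dimension of its kernel (`mem_range_of_approx_surjective`).

To work with bounded operators, `D(A)` is parametrized as `u = R v` by a resolvent `R` of `A`, so
that the unknown is `(v, μ)` in `L² × ℂ`. The fixed point map has Lipschitz constant `O(ρ + ε)` on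
the ball of radius `ρ`, and at `0` it equals `ε q₀ + O(ε^(1+τ))`, where `q₀` solves the bordered
problem with right-hand side `g |φ₀|^(1/α) φ₀`. This gives existence, uniqueness and the expansion
at once (`exists_fixedPoint_branch`).

For the symmetry, the map preserves the closed set of pairs with `ℬ u = u` and `μ` real
(`PT_reducedMap`, `symmetric_of_bordered`). The contraction can be run inside this set, while
uniqueness holds in the whole ball, so the only solution is the symmetric one. -/

theorem ae_comp_neg {p : Rd d → Prop} (h : ∀ᵐ x, p x) : ∀ᵐ x : Rd d, p (-x) :=
  (Measure.measurePreserving_neg (volume : Measure (Rd d))).quasiMeasurePreserving.ae h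

theorem PT_add (u v : L2 d) : PT (u + v) = PT u + PT v := by
  apply Lp.ext
  filter_upwards [coeFn_PT (u + v), coeFn_PT u, coeFn_PT v, Lp.coeFn_add (PT u) (PT v),
    ae_comp_neg (Lp.coeFn_add u v)] with x h1 h2 h3 h4 h5
  rw [h1, h4, Pi.add_apply, h2, h3, h5, Pi.add_apply, map_add]

theorem PT_smul (c : ℂ) (u : L2 d) : PT (c • u) = conj c • PT u := by
  apply Lp.ext
  filter_upwards [coeFn_PT (c • u), coeFn_PT u, Lp.coeFn_smul (conj c) (PT u),
    ae_comp_neg (Lp.coeFn_smul c u)] with x h1 h2 h4 h5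
  rw [h1, h4, Pi.smul_apply, h2, h5, Pi.smul_apply, smul_eq_mul, smul_eq_mul, map_mul]

theorem PT_sub (u v : L2 d) : PT (u - v) = PT u - PT v := by
  have h : u - v = u + (-1 : ℂ) • v := by module
  rw [h, PT_add, PT_smul, map_neg, map_one]
  module

theorem PT_zero : PT (0 : L2 d) = 0 := by
  simpa using PT_sub (0 : L2 d) 0

theorem norm_PT (u : L2 d) : ‖PT u‖ = ‖u‖ := by
  rw [PT, Lp.norm_toLp, Lp.norm_def]
  congr 1
  have h : eLpNorm (ptFun u) 2 volume = eLpNorm (fun x => (u : Rd d → ℂ) (-x)) 2 volume :=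
    eLpNorm_congr_norm_ae (Filter.Eventually.of_forall fun x => by simp [ptFun])
  rw [h]
  exact eLpNorm_comp_measurePreserving (Lp.aestronglyMeasurable u)
    (Measure.measurePreserving_neg volume)

theorem continuous_PT : Continuous (PT : L2 d → L2 d) := by
  have h : Isometry (PT : L2 d → L2 d) := Isometry.of_dist_eq fun u v => by
    rw [dist_eq_norm, dist_eq_norm, ← PT_sub, norm_PT]
  exact h.continuous

/-! ### Multiplication operators -/

theorem norm_mulOp_le {w : Rd d → ℂ} (hw : MemLp w ∞ volume) {c : ℝ} (hc : 0 ≤ c)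
    (h : ∀ᵐ x, ‖w x‖ ≤ c) : ‖mulOp w‖ ≤ c := by
  refine ContinuousLinearMap.opNorm_le_bound _ hc fun u => ?_
  apply Lp.norm_le_mul_norm_of_ae_le_mul
  filter_upwards [coeFn_mulOp hw u, h] with x h1 h2
  rw [h1, norm_mul]
  gcongr

theorem mulOp_sub {w₁ w₂ : Rd d → ℂ} (h₁ : MemLp w₁ ∞ volume) (h₂ : MemLp w₂ ∞ volume) :
    mulOp (fun x => w₁ x - w₂ x) = mulOp w₁ - mulOp w₂ := by
  ext1 u
  apply Lp.ext
  rw [sub_apply]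
  filter_upwards [coeFn_mulOp (h₁.sub h₂) u, coeFn_mulOp h₁ u, coeFn_mulOp h₂ u,
    Lp.coeFn_sub (mulOp w₁ u) (mulOp w₂ u)] with x e e1 e2 e3
  rw [e3, Pi.sub_apply, e1, e2, ← sub_mul]
  exact e

theorem mulOp_const_mul {w : Rd d → ℂ} (h : MemLp w ∞ volume) (c : ℂ) :
    mulOp (fun x => c * w x) = c • mulOp w := by
  ext1 u
  apply Lp.ext
  rw [smul_apply]
  filter_upwards [coeFn_mulOp (h.const_mul c) u, coeFn_mulOp h u,
    Lp.coeFn_smul c (mulOp w u)] with x e e1 e3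
  rw [e3, Pi.smul_apply, e1, smul_eq_mul, ← mul_assoc]
  exact e

theorem PT_mulOp {w : Rd d → ℂ} (h : MemLp w ∞ volume) (hw : PTFunction w) (u : L2 d) :
    PT (mulOp w u) = mulOp w (PT u) := by
  apply Lp.ext
  filter_upwards [coeFn_PT (mulOp w u), coeFn_mulOp h (PT u), coeFn_PT u, hw,
    ae_comp_neg (coeFn_mulOp h u)] with x h1 h2 h3 h4 h5
  rw [h1, h2, h3, h5, map_mul, h4]

/-! ### Holomorphic dependence of the potential on the parameter -/

/-- Cauchy's estimate applied twice bounds `h''` near the centre by a constant depending only on `c`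
and `δ`; the mean value inequality is then applied to `h'` and to `h y - y h'(a)`. The explicit
constant makes the bound uniform in `x` when `h = W x`. -/
theorem norm_sub_sub_deriv_le {h : ℂ → ℂ} {a : ℂ} {δ c ρ : ℝ} (hδ : 0 < δ)
    (hd : DifferentiableOn ℂ h (Metric.ball a δ)) (hb : ∀ z ∈ Metric.ball a δ, ‖h z‖ ≤ c)
    (hρ : ρ ≤ δ / 4) {z w : ℂ} (hz : z ∈ Metric.closedBall a ρ) (hw : w ∈ Metric.closedBall a ρ) :
    ‖h z - h w - (z - w) * deriv h a‖ ≤ 32 * c / δ ^ 2 * ρ * ‖z - w‖ := by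
  have hd1 : ∀ y ∈ Metric.ball a δ, ‖y - a‖ ≤ δ / 2 → ‖deriv h y‖ ≤ c / (δ / 4) := by
    intro y _ hy
    have hsub : Metric.closedBall y (δ / 4) ⊆ Metric.ball a δ := by
      apply Metric.closedBall_subset_ball'
      rw [dist_eq_norm]; linarith
    refine Complex.norm_deriv_le_of_forall_mem_sphere_norm_le (by positivity) ?_ fun x hx =>
      hb x (hsub (Metric.sphere_subset_closedBall hx))
    exact (hd.mono hsub).diffContOnCl_ball subset_rfl
  have hdd : DifferentiableOn ℂ (deriv h) (Metric.ball a δ) := hd.deriv Metric.isOpen_ball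
  have hd2 : ∀ y, ‖y - a‖ ≤ δ / 4 → ‖deriv (deriv h) y‖ ≤ c / (δ / 4) / (δ / 8) := by
    intro y hy
    have hsub : Metric.closedBall y (δ / 8) ⊆ Metric.closedBall a (δ / 2) := by
      apply Metric.closedBall_subset_closedBall'
      rw [dist_eq_norm]; linarith
    have hsub' : Metric.closedBall a (δ / 2) ⊆ Metric.ball a δ :=
      Metric.closedBall_subset_ball (by linarith)
    refine Complex.norm_deriv_le_of_forall_mem_sphere_norm_le (by positivity) ?_ fun x hx => ?_
    · exact (hdd.mono (hsub.trans hsub')).diffContOnCl_ball subset_rfl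
    · have hx' := hsub (Metric.sphere_subset_closedBall hx)
      exact hd1 x (hsub' hx') (by simpa [dist_eq_norm] using hx')
  have hball : ∀ y ∈ Metric.closedBall a ρ, y ∈ Metric.ball a δ := fun y hy => by
    rw [Metric.mem_closedBall] at hy; rw [Metric.mem_ball]; linarith
  have hρ0 : 0 ≤ ρ := dist_nonneg.trans hz
  have hc : 0 ≤ c := (norm_nonneg _).trans (hb a (Metric.mem_ball_self hδ))
  have hd3 : ∀ y ∈ Metric.closedBall a ρ, ‖deriv h y - deriv h a‖ ≤ 32 * c / δ ^ 2 * ρ := by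
    intro y hy
    have := (convex_closedBall a ρ).norm_image_sub_le_of_norm_deriv_le (𝕜 := ℂ) (f := deriv h)
      (C := c / (δ / 4) / (δ / 8))
      (fun x hx => hdd.differentiableAt (Metric.isOpen_ball.mem_nhds (hball x hx)))
      (fun x hx => hd2 x ((by simpa [dist_eq_norm] using hx : ‖x - a‖ ≤ ρ).trans hρ))
      (Metric.mem_closedBall_self hρ0) hy
    refine this.trans ?_
    have e : c / (δ / 4) / (δ / 8) = 32 * c / δ ^ 2 := by field_simp; ring
    rw [e]
    gcongr
    simpa [dist_eq_norm] using hy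
  have := (convex_closedBall a ρ).norm_image_sub_le_of_norm_hasDerivWithin_le (𝕜 := ℂ)
      (f := fun y => h y - y * deriv h a) (f' := fun y => deriv h y - 1 * deriv h a)
      (C := 32 * c / δ ^ 2 * ρ)
      (fun x hx => ((hd.differentiableAt (Metric.isOpen_ball.mem_nhds
        (hball x hx))).hasDerivAt.sub ((hasDerivAt_id x).mul_const _)).hasDerivWithinAt)
      (fun x hx => by rw [one_mul]; exact hd3 x hx) hw hz
  have e : h z - h w - (z - w) * deriv h a
      = h z - z * deriv h a - (h w - w * deriv h a) := by ring
  rw [e]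
  exact this

/-- The hypothesis gives a null set for each `ω`. A single null set suffices on a countable dense
set of parameters, and continuity of `W x` extends the bound to the whole ball. -/
theorem AssumptionW.ae_bound {W : Rd d → ℂ → ℂ} {ω₀ : ℂ} {δ : ℝ} (hW : AssumptionW W ω₀ δ) :
    ∃ c : ℝ, 0 ≤ c ∧ ∀ᵐ x, ∀ ω ∈ Metric.ball ω₀ δ, ‖W x ω‖ ≤ c := by
  obtain ⟨c, hc⟩ := hW.bounded
  refine ⟨max c 0, le_max_right _ _, ?_⟩
  obtain ⟨D, hDc, hDd⟩ := TopologicalSpace.exists_countable_dense ℂ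
  have h1 : ∀ᵐ x, ∀ ω ∈ D ∩ Metric.ball ω₀ δ, ‖W x ω‖ ≤ max c 0 := by
    rw [ae_ball_iff (hDc.mono inter_subset_left)]
    intro ω hω
    have h2 := (hc ω hω.2).2
    filter_upwards [ae_le_eLpNormEssSup (f := fun x => W x ω) (μ := volume)] with x hx
    rw [eLpNorm_exponent_top] at h2
    have h3 := hx.trans h2
    rw [← ofReal_norm] at h3
    rcases le_or_gt 0 c with h0 | h0
    · exact ((ENNReal.ofReal_le_ofReal_iff h0).1 h3).trans (le_max_left _ _)
    · rw [ENNReal.ofReal_of_nonpos h0.le, nonpos_iff_eq_zero, ENNReal.ofReal_eq_zero] at h3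
      exact h3.trans (le_max_right _ _)
  filter_upwards [h1, hW.holomorphic] with x hx hh ω hω
  have hcl : ω ∈ closure (Metric.ball ω₀ δ ∩ D) :=
    hDd.open_subset_closure_inter Metric.isOpen_ball hω
  have hcont : ContinuousWithinAt (fun ω => ‖W x ω‖) (Metric.ball ω₀ δ ∩ D) ω :=
    ((hh.continuousOn ω hω).mono inter_subset_left).norm
  exact hcont.closure_le hcl continuousWithinAt_const fun y hy => hx y ⟨hy.2, hy.1⟩

/-- The derivative of the potential is in `L^∞`, and the multiplication operators are strictly
differentiable at the centre. -/
theorem AssumptionW.mulOp_expansion {W : Rd d → ℂ → ℂ} {ω₀ : ℂ} {δ : ℝ} (hδ : 0 < δ)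
    (hW : AssumptionW W ω₀ δ) :
    MemLp (fun x => deriv (W x) ω₀) ∞ volume ∧ ∃ C : ℝ, 0 ≤ C ∧
      ∀ ρ ≤ δ / 4, ∀ ω₁ ∈ Metric.closedBall ω₀ ρ, ∀ ω₂ ∈ Metric.closedBall ω₀ ρ,
        ‖mulOp (fun x => W x ω₁) - mulOp (fun x => W x ω₂)
          - (ω₁ - ω₂) • mulOp (fun x => deriv (W x) ω₀)‖ ≤ C * ρ * ‖ω₁ - ω₂‖ := by
  obtain ⟨c, hc0, hc⟩ := hW.ae_bound
  obtain ⟨_, hm⟩ := hW.bounded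
  have hD : MemLp (fun x => deriv (W x) ω₀) ∞ volume := by
    -- The derivative is an a.e. limit of measurable difference quotients along a real sequence
    -- decreasing to `0`.
    have hmeas : AEStronglyMeasurable (fun x => deriv (W x) ω₀) (volume : Measure (Rd d)) := by
      obtain ⟨u, -, hu, hu0⟩ := exists_seq_strictAnti_tendsto' (α := ℝ) (half_pos hδ)
      have hmem : ∀ n, ω₀ + (u n : ℂ) ∈ Metric.ball ω₀ δ := fun n => by
        have := hu n
        rw [Metric.mem_ball, dist_eq_norm, add_sub_cancel_left, Complex.norm_real,
          Real.norm_of_nonneg this.1.le]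
        linarith [this.2]
      refine aestronglyMeasurable_of_tendsto_ae Filter.atTop
        (f := fun n x => (u n : ℂ)⁻¹ • (W x (ω₀ + u n) - W x ω₀)) (fun n => ?_) ?_
      · exact (((hm _ (hmem n)).1.aestronglyMeasurable).sub
          (hm _ (Metric.mem_ball_self hδ)).1.aestronglyMeasurable).const_smul (u n : ℂ)⁻¹
      · filter_upwards [hW.holomorphic] with x hx
        have hd := (hx.differentiableAt (Metric.ball_mem_nhds ω₀ hδ)).hasDerivAt
        rw [hasDerivAt_iff_tendsto_slope_zero] at hd
        refine hd.comp (tendsto_nhdsWithin_iff.2 ⟨?_, ?_⟩)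
        · exact (Complex.continuous_ofReal.tendsto' 0 0 (by simp)).comp hu0
        · exact Filter.Eventually.of_forall fun n => by
            simpa using (hu n).1.ne'
    refine memLp_top_of_bound hmeas (c / (δ / 2)) ?_
    filter_upwards [hc, hW.holomorphic] with x hx hh
    have hsub : Metric.closedBall ω₀ (δ / 2) ⊆ Metric.ball ω₀ δ :=
      Metric.closedBall_subset_ball (by linarith)
    exact Complex.norm_deriv_le_of_forall_mem_sphere_norm_le (by positivity)
      ((hh.mono hsub).diffContOnCl_ball subset_rfl) fun y hy =>
        hx y (hsub (Metric.sphere_subset_closedBall hy))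
  refine ⟨hD, 32 * c / δ ^ 2, by positivity, fun ρ hρ ω₁ h₁ ω₂ h₂ => ?_⟩
  have hsub : Metric.closedBall ω₀ ρ ⊆ Metric.ball ω₀ δ :=
    Metric.closedBall_subset_ball (by linarith)
  have m₁ := (hm ω₁ (hsub h₁)).1
  have m₂ := (hm ω₂ (hsub h₂)).1
  rw [← mulOp_sub m₁ m₂, ← mulOp_const_mul hD,
    ← mulOp_sub (w₁ := fun x => W x ω₁ - W x ω₂) (m₁.sub m₂) (hD.const_mul _)]
  have hρ0 : 0 ≤ ρ := dist_nonneg.trans h₁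
  refine norm_mulOp_le ((m₁.sub m₂).sub (hD.const_mul _)) (by positivity) ?_
  filter_upwards [hc, hW.holomorphic] with x hx hh
  exact norm_sub_sub_deriv_le hδ hh hx hρ h₁ h₂

/-! ### Two abstract results -/

/-- A family of maps which are contractions with small constants near `0` has a unique branch of
fixed points, inside any closed invariant set containing `0`. -/
theorem exists_fixedPoint_branch {E : Type*} [NormedAddCommGroup E] [NormedSpace ℂ E]
    [CompleteSpace E] (Φ : ℝ → E → E) (G : E) {S : Set E} (hS : IsClosed S) (h0 : (0 : E) ∈ S)
    {κ ρ₁ ε₁ τ : ℝ} (hκ : 0 < κ) (hρ₁ : 0 < ρ₁) (hε₁ : 0 < ε₁) (hτ0 : 0 < τ) (hτ : τ ≤ 1)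
    (hinv : ∀ ε ∈ Ioo 0 ε₁, ∀ p ∈ S, ‖p‖ ≤ ρ₁ → Φ ε p ∈ S)
    (hlip : ∀ ε ∈ Ioo 0 ε₁, ∀ ρ ≤ ρ₁, ∀ p q, ‖p‖ ≤ ρ → ‖q‖ ≤ ρ →
      ‖Φ ε p - Φ ε q‖ ≤ κ * (ρ + ε) * ‖p - q‖)
    (hG : ∀ ε ∈ Ioo 0 ε₁, ‖Φ ε 0 - (ε : ℂ) • G‖ ≤ κ * ε ^ (1 + τ)) :
    ∃ ρ, 0 < ρ ∧ ρ ≤ ρ₁ ∧ ∃ C, 0 < C ∧ ∃ ε₀, 0 < ε₀ ∧ ε₀ ≤ ε₁ ∧ ∀ ε ∈ Ioo 0 ε₀,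
      ∃ p ∈ S, ‖p‖ ≤ C * ε ∧ ‖p‖ ≤ ρ ∧ Φ ε p = p ∧ (∀ q, ‖q‖ ≤ ρ → Φ ε q = q → q = p) ∧
        ‖p - (ε : ℂ) • G‖ ≤ C * ε ^ (1 + τ) := by
  -- With `κ ρ ≤ 1/4` and `κ ε ≤ 1/4` the Lipschitz constant is at most `1/2`; the bound `B ε ≤ ρ/2`
  -- below then makes the ball of radius `ρ` invariant.
  set ρ := min ρ₁ (1 / (4 * κ)) with hρ
  have hρ0 : 0 < ρ := lt_min hρ₁ (by positivity)
  have hκρ : κ * ρ ≤ 1 / 4 := by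
    have : κ * ρ ≤ κ * (1 / (4 * κ)) := by gcongr; exact min_le_right _ _
    exact this.trans (by field_simp; rfl)
  set B := ‖G‖ + κ with hB
  have hB0 : 0 < B := by positivity
  set ε₀ := min (min ε₁ 1) (min (1 / (4 * κ)) (ρ / (2 * B))) with hε₀
  refine ⟨ρ, hρ0, min_le_left _ _, max (2 * B) (κ * ((2 * B + 1) * (2 * B)) + κ),
    lt_max_of_lt_left (by positivity), ε₀, by positivity, (min_le_left _ _).trans (min_le_left _ _),
    fun ε hε => ?_⟩
  obtain ⟨hε0, hεlt⟩ := hε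
  have hεε₁ : ε ∈ Ioo 0 ε₁ :=
    ⟨hε0, hεlt.trans_le ((min_le_left _ _).trans (min_le_left _ _))⟩
  have hε1 : ε ≤ 1 := hεlt.le.trans ((min_le_left _ _).trans (min_le_right _ _))
  have hκε : κ * ε ≤ 1 / 4 := by
    have : κ * ε ≤ κ * (1 / (4 * κ)) := by
      gcongr; exact hεlt.le.trans ((min_le_right _ _).trans (min_le_left _ _))
    exact this.trans (by field_simp; rfl)
  have hBε : B * ε ≤ ρ / 2 := by
    have : B * ε ≤ B * (ρ / (2 * B)) := by
      gcongr; exact hεlt.le.trans ((min_le_right _ _).trans (min_le_right _ _))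
    exact this.trans (by field_simp; rfl)
  have hpow : ε ^ (1 + τ) ≤ ε := by
    simpa using Real.rpow_le_rpow_of_exponent_ge hε0 hε1 (by linarith : (1 : ℝ) ≤ 1 + τ)
  have hpow2 : ε * ε ≤ ε ^ (1 + τ) := by
    have := Real.rpow_le_rpow_of_exponent_ge hε0 hε1 (by linarith : 1 + τ ≤ (2 : ℝ))
    simpa [pow_two] using this
  have hΦ0 : ‖Φ ε 0‖ ≤ B * ε := by
    have h1 : ‖Φ ε 0‖ ≤ ‖Φ ε 0 - (ε : ℂ) • G‖ + ‖(ε : ℂ) • G‖ := by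
      simpa using norm_add_le (Φ ε 0 - (ε : ℂ) • G) ((ε : ℂ) • G)
    rw [norm_smul, Complex.norm_real, Real.norm_of_nonneg hε0.le] at h1
    have h2 := hG ε hεε₁
    have h3 : κ * ε ^ (1 + τ) ≤ κ * ε := by gcongr
    rw [hB]; linarith
  have hhalf : ∀ p q, ‖p‖ ≤ ρ → ‖q‖ ≤ ρ → ‖Φ ε p - Φ ε q‖ ≤ 1 / 2 * ‖p - q‖ := by
    intro p q hp hq
    refine (hlip ε hεε₁ ρ (min_le_left _ _) p q hp hq).trans ?_
    gcongr
    linarith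
  have hself : ∀ p, ‖p‖ ≤ ρ → ‖Φ ε p‖ ≤ 1 / 2 * ‖p‖ + B * ε := by
    intro p hp
    have h1 := hhalf p 0 hp (by simpa using hρ0.le)
    have h2 : ‖Φ ε p‖ ≤ ‖Φ ε p - Φ ε 0‖ + ‖Φ ε 0‖ := by
      simpa using norm_add_le (Φ ε p - Φ ε 0) (Φ ε 0)
    rw [sub_zero] at h1
    linarith
  have hmaps : MapsTo (Φ ε) (S ∩ Metric.closedBall 0 ρ) (S ∩ Metric.closedBall 0 ρ) := by
    rintro p ⟨hpS, hp⟩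
    rw [mem_closedBall_zero_iff] at hp
    refine ⟨hinv ε hεε₁ p hpS (hp.trans (min_le_left _ _)), ?_⟩
    rw [mem_closedBall_zero_iff]
    linarith [hself p hp]
  have hcontr : ContractingWith (1 / 2 : NNReal) (hmaps.restrict (Φ ε) _ _) := by
    refine ⟨by norm_num [← NNReal.coe_lt_coe], LipschitzWith.of_dist_le_mul fun p q => ?_⟩
    have hp := p.2.2
    have hq := q.2.2
    rw [mem_closedBall_zero_iff] at hp hq
    rw [Subtype.dist_eq, Subtype.dist_eq, dist_eq_norm, dist_eq_norm]
    simpa using hhalf p q hp hq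
  obtain ⟨p, ⟨hpS, hpρ⟩, hfix, -, -⟩ := hcontr.exists_fixedPoint'
    (hS.inter Metric.isClosed_closedBall).isComplete hmaps (x := 0)
    ⟨h0, by simpa using hρ0.le⟩ (edist_ne_top _ _)
  rw [mem_closedBall_zero_iff] at hpρ
  have hfix : Φ ε p = p := hfix
  have hp1 : ‖p‖ ≤ 2 * B * ε := by
    have := hself p hpρ
    rw [hfix] at this
    linarith
  refine ⟨p, hpS, hp1.trans (by gcongr; exact le_max_left _ _), hpρ, hfix, ?_, ?_⟩
  · intro q hq hqf
    have := hhalf q p hq hpρ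
    rw [hqf, hfix] at this
    have h2 : ‖q - p‖ = 0 := le_antisymm (by linarith) (norm_nonneg _)
    exact sub_eq_zero.1 (norm_eq_zero.1 h2)
  -- The Lipschitz bound is used with radius `‖p‖ = O(ε)` instead of `ρ`: the error is then `O(ε²)`,
  -- which `τ ≤ 1` absorbs into `ε^(1+τ)`.
  · have h1 := hlip ε hεε₁ ‖p‖ (hpρ.trans (min_le_left _ _)) p 0 le_rfl (by simp)
    rw [hfix, sub_zero] at h1
    have h2 : ‖p - (ε : ℂ) • G‖ ≤ ‖p - Φ ε 0‖ + ‖Φ ε 0 - (ε : ℂ) • G‖ := norm_sub_le_norm_sub_add_norm_sub ..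
    have h3 : κ * (‖p‖ + ε) * ‖p‖ ≤ κ * (2 * B * ε + ε) * (2 * B * ε) := by gcongr
    have h4 : κ * (2 * B * ε + ε) * (2 * B * ε) ≤ κ * ((2 * B + 1) * (2 * B)) * ε ^ (1 + τ) := by
      calc κ * (2 * B * ε + ε) * (2 * B * ε) = κ * ((2 * B + 1) * (2 * B)) * (ε * ε) := by ring
        _ ≤ _ := by gcongr
    calc ‖p - (ε : ℂ) • G‖ ≤ (κ * ((2 * B + 1) * (2 * B)) + κ) * ε ^ (1 + τ) := by
          linarith [hG ε hεε₁]
      _ ≤ _ := by gcongr; exact le_max_right _ _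

/-- A bounded operator with one-dimensional kernel and closed range that is a limit of surjective
operators has a range of codimension at most one. -/
theorem mem_range_of_approx_surjective {H : Type*} [NormedAddCommGroup H] [InnerProductSpace ℂ H]
    [CompleteSpace H] (T : H →L[ℂ] H) (ℓ : H →L[ℂ] ℂ) (v₀ n₀ : H) (hTv₀ : T v₀ = 0)
    (hℓ : ℓ v₀ = 1) (hker : ∀ v, T v = 0 → ∃ c : ℂ, v = c • v₀) (hcl : IsClosed (range T))
    (hn₀ : ∀ v, inner ℂ n₀ (T v) = 0) (hne : n₀ ≠ 0)
    (happrox : ∀ e > 0, ∃ T' : H →L[ℂ] H, ‖T - T'‖ ≤ e ∧ Function.Surjective T')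
    {y : H} (hy : inner ℂ n₀ y = 0) : ∃ v, T v = y := by
  -- `T` is bounded below on `ker ℓ`: the pair `(T, ℓ)` is injective, and its range is `ran T × ℂ`,
  -- hence closed, since moving along `v₀` changes `ℓ` without changing `T`.
  have hlow : ∃ e : ℝ, 0 < e ∧ ∀ v, ℓ v = 0 → e * ‖v‖ ≤ ‖T v‖ := by
    have hinj : Function.Injective (T.prod ℓ) := by
      rw [injective_iff_map_eq_zero]
      intro v hv
      obtain ⟨h1, h2⟩ : T v = 0 ∧ ℓ v = 0 := by simpa using hv
      obtain ⟨c, rfl⟩ := hker v h1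
      rw [map_smul, hℓ, smul_eq_mul, mul_one] at h2
      rw [h2, zero_smul]
    have hran : range (T.prod ℓ) = range T ×ˢ univ := by
      ext ⟨a, s⟩
      constructor
      · rintro ⟨v, hv⟩
        exact ⟨⟨v, congrArg Prod.fst hv⟩, mem_univ _⟩
      · rintro ⟨⟨v, hv⟩, -⟩
        refine ⟨v + (s - ℓ v) • v₀, ?_⟩
        have hv : T v = a := hv
        simp [hv, hTv₀, hℓ]
    obtain ⟨K, hK⟩ := (T.prod ℓ).antilipschitz_of_injective_of_isClosed_range hinj
      (by rw [hran]; exact hcl.prod isClosed_univ)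
    refine ⟨((K : ℝ) + 1)⁻¹, by positivity, fun v hv => ?_⟩
    have h1 := hK.le_mul_dist v 0
    have h2 : ‖(T.prod ℓ) v‖ = ‖T v‖ := by
      simp [Prod.norm_def, hv]
    rw [dist_zero_right, map_zero, dist_zero_right, h2] at h1
    rw [inv_mul_le_iff₀ (by positivity)]
    nlinarith [norm_nonneg (T v)]
  obtain ⟨e, he, hlow⟩ := hlow
  let R : Submodule ℂ H := LinearMap.range T.toLinearMap
  have hRc : IsClosed (R : Set H) := hcl
  have : CompleteSpace R := hRc.completeSpace_coe
  by_contra hyR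
  have hyR : y ∉ R := fun h => hyR h
  set n := y - R.starProjection y with hn
  have hnR : n ∈ Rᗮ := R.sub_starProjection_mem_orthogonal y
  have hn0 : n ≠ 0 := fun h => hyR (by
    rw [sub_eq_zero.1 h]; exact R.starProjection_apply_mem y)
  have hnR' : ∀ v, inner ℂ n (T v) = 0 := fun v =>
    Submodule.inner_left_of_mem_orthogonal (K := R) ⟨v, rfl⟩ hnR
  have hn₀n : inner ℂ n₀ n = 0 := by
    obtain ⟨v, hv⟩ : R.starProjection y ∈ R := R.starProjection_apply_mem y
    have hv : T v = R.starProjection y := hv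
    rw [hn, inner_sub_right, hy, ← hv, hn₀, sub_zero]
  obtain ⟨T', hTT', hT'⟩ := happrox e he
  -- If `y` were not in the range, `n₀` and `n` would span a plane orthogonal to `ran T`. Preimages
  -- of both under `T'` have a combination in `ker ℓ` whose image `m` is a nonzero vector of that
  -- plane.
  obtain ⟨v, m, hv, hm, hTm, hmR⟩ : ∃ v m, ℓ v = 0 ∧ m ≠ 0 ∧ T' v = m ∧
      ∀ w, inner ℂ m (T w) = 0 := by
    obtain ⟨v₁, hv₁⟩ := hT' n₀
    obtain ⟨v₂, hv₂⟩ := hT' n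
    by_cases h : ℓ v₂ = 0
    · exact ⟨v₂, n, h, hn0, hv₂, hnR'⟩
    · refine ⟨v₁ - (ℓ v₁ / ℓ v₂) • v₂, n₀ - (ℓ v₁ / ℓ v₂) • n, ?_, ?_, ?_, fun w => ?_⟩
      · rw [map_sub, map_smul, smul_eq_mul, div_mul_cancel₀ _ h, sub_self]
      · intro h0
        have : inner ℂ n₀ (n₀ - (ℓ v₁ / ℓ v₂) • n) = 0 := by rw [h0, inner_zero_right]
        rw [inner_sub_right, inner_smul_right, hn₀n, mul_zero, sub_zero, inner_self_eq_zero] at this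
        exact hne this
      · rw [map_sub, map_smul, hv₁, hv₂]
      · rw [inner_sub_left, inner_smul_left, hn₀, hnR', mul_zero, sub_zero]
  have h1 : ‖T v - m‖ ≤ ‖T v‖ := by
    calc ‖T v - m‖ = ‖(T - T') v‖ := by rw [← hTm, sub_apply]
      _ ≤ ‖T - T'‖ * ‖v‖ := (T - T').le_opNorm v
      _ ≤ e * ‖v‖ := by gcongr
      _ ≤ ‖T v‖ := hlow v hv
  -- Pythagoras makes `T v - m` strictly longer than `T v`, against `h1`.
  have h2 : ‖T v - m‖ * ‖T v - m‖ = ‖T v‖ * ‖T v‖ + ‖m‖ * ‖m‖ := by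
    have h3 : inner ℂ (T v) m = 0 := by
      rw [← inner_conj_symm, hmR, map_zero]
    have := norm_add_sq_eq_norm_sq_add_norm_sq_of_inner_eq_zero (𝕜 := ℂ) (T v) (-m)
      (by rw [inner_neg_right, h3, neg_zero])
    rwa [← sub_eq_add_neg, norm_neg] at this
  have h4 : 0 < ‖m‖ := norm_pos_iff.2 hm
  nlinarith [norm_nonneg (T v - m), norm_nonneg (T v)]

/-! ### The linearization -/

theorem AssumptionW.mulOp_lipschitz {W : Rd d → ℂ → ℂ} {ω₀ : ℂ} {δ : ℝ} (hδ : 0 < δ)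
    (hW : AssumptionW W ω₀ δ) : ∃ C : ℝ, 0 < C ∧ ∀ ω ∈ Metric.closedBall ω₀ (δ / 4),
      ‖mulOp (fun x => W x ω) - mulOp (fun x => W x ω₀)‖ ≤ C * ‖ω - ω₀‖ := by
  obtain ⟨-, C, hC, h⟩ := hW.mulOp_expansion hδ
  refine ⟨C * (δ / 4) + ‖mulOp (fun x => deriv (W x) ω₀)‖ + 1, by positivity, fun ω hω => ?_⟩
  have h1 := h (δ / 4) le_rfl ω hω ω₀ (Metric.mem_closedBall_self (by positivity))
  have h2 := norm_add_le (mulOp (fun x => W x ω) - mulOp (fun x => W x ω₀)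
    - (ω - ω₀) • mulOp (fun x => deriv (W x) ω₀)) ((ω - ω₀) • mulOp (fun x => deriv (W x) ω₀))
  rw [sub_add_cancel, norm_smul] at h2
  nlinarith [norm_nonneg (ω - ω₀)]

theorem inner_opL_eq_zero {A : Op d} {W : Rd d → ℂ → ℂ} {ω₀ : ℂ} {φ₀ : A.domain} {φs : L2 d}
    (hA : AssumptionA A) (hnorm : Normalized A W ω₀ φ₀ φs) (u : A.domain) :
    inner ℂ φs (A u - mulOp (fun x => W x ω₀) u) = 0 := by
  obtain ⟨h, h0⟩ := hnorm.adjoint_ker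
  have := LinearPMap.adjoint_isFormalAdjoint (T := opL A W ω₀) hA.dense ⟨φs, h⟩ u
  rw [h0, inner_zero_left] at this
  exact this.symm

/-- The range of `L(ω₀)` is the orthogonal complement of the adjoint eigenfunction. -/
theorem exists_opL_eq {A : Op d} {W : Rd d → ℂ → ℂ} {ω₀ : ℂ} {δ : ℝ} {φ₀ : A.domain} {φs : L2 d}
    (hδ : 0 < δ) (hA : AssumptionA A) (hW : AssumptionW W ω₀ δ)
    (hsimple : AlgebraicallySimple A W ω₀ φ₀) (hisol : Isolated A W ω₀)
    (hnorm : Normalized A W ω₀ φ₀ φs) {y : L2 d} (hy : inner ℂ φs y = 0) :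
    ∃ u : A.domain, A u - mulOp (fun x => W x ω₀) u = y := by
  obtain ⟨z, R, hR, hRA⟩ := hA.resolvent
  choose hR hAR using hR
  -- Since `A R = z R - 1`, this is the bounded operator `L(ω) R`, which has the same range as
  -- `L(ω)`.
  let T : ℂ → L2 d →L[ℂ] L2 d := fun ω =>
    z • R - ContinuousLinearMap.id ℂ _ - (mulOp fun x => W x ω) ∘L R
  have hT : ∀ ω v, T ω v = A ⟨R v, hR v⟩ - mulOp (fun x => W x ω) (R v) := fun ω v => by
    have := hAR v
    rw [sub_eq_iff_eq_add', ← sub_eq_iff_eq_add] at this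
    simp [T, ← this]
  have hTu : ∀ ω (u : A.domain), T ω (z • (u : L2 d) - A u) = A u - mulOp (fun x => W x ω) u := by
    intro ω u
    have e : (⟨R (z • (u : L2 d) - A u), hR _⟩ : A.domain) = u := Subtype.ext (hRA u)
    rw [hT, e, hRA]
  have hrange : range (T ω₀) = range fun u : (opL A W ω₀).domain => opL A W ω₀ u := by
    ext y
    constructor
    · rintro ⟨v, rfl⟩
      exact ⟨⟨R v, hR v⟩, (hT _ _).symm⟩
    · rintro ⟨u, rfl⟩
      exact ⟨_, hTu _ u⟩
  have hφs : φs ≠ 0 := by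
    rintro rfl
    simpa using hnorm.inner_one
  have hφ₀ : R (z • (φ₀ : L2 d) - A φ₀) = φ₀ := hRA φ₀
  obtain ⟨v, hv⟩ := mem_range_of_approx_surjective (T ω₀) ((innerSL ℂ φs) ∘L R)
    (z • (φ₀ : L2 d) - A φ₀) φs
    (by rw [hTu]; exact (hsimple.ker φ₀).2 ⟨1, by simp⟩)
    (by simp only [ContinuousLinearMap.comp_apply, hφ₀]; exact hnorm.inner_one)
    (fun v hv => by
      rw [hT] at hv
      obtain ⟨c, hc⟩ := (hsimple.ker ⟨R v, hR v⟩).1 hv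
      have hc : R v = c • (φ₀ : L2 d) := hc
      refine ⟨c, ?_⟩
      have h1 := hAR v
      have h2 : (⟨R v, hR v⟩ : A.domain) = c • φ₀ := Subtype.ext hc
      rw [h2, LinearPMap.map_smul, hc] at h1
      rw [← h1]; module)
    (by rw [hrange]; exact hsimple.closed_range)
    (fun v => by rw [hT]; exact inner_opL_eq_zero hA hnorm ⟨R v, hR v⟩) hφs
    (fun e he => by
      obtain ⟨C, hC, hL⟩ := hW.mulOp_lipschitz hδ
      obtain ⟨ρ, hρ, hiso⟩ := hisol
      -- The parameter `ω₀ + s` is close enough for the operator bound `e`, and lies in the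
      -- punctured disc where isolation makes `L(ω₀ + s)` invertible.
      let s : ℝ := min (min (δ / 4) (ρ / 2)) (e / (C * (‖R‖ + 1)))
      have hs : 0 < s := by positivity
      have hs1 : s ≤ δ / 4 := (min_le_left _ _).trans (min_le_left _ _)
      have hs2 : s ≤ ρ / 2 := (min_le_left _ _).trans (min_le_right _ _)
      have hs3 : s ≤ e / (C * (‖R‖ + 1)) := min_le_right _ _
      have hsn : ‖(ω₀ + (s : ℂ)) - ω₀‖ = s := by
        rw [add_sub_cancel_left, Complex.norm_real, Real.norm_of_nonneg hs.le]
      refine ⟨T (ω₀ + s), ?_, fun y => ?_⟩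
      · have h1 := hL (ω₀ + s) (by rw [Metric.mem_closedBall, dist_eq_norm, hsn]; exact hs1)
        have h2 : T ω₀ - T (ω₀ + s)
            = ((mulOp fun x => W x (ω₀ + s)) - mulOp fun x => W x ω₀) ∘L R := by
          simp only [T, ContinuousLinearMap.sub_comp]; abel
        rw [hsn] at h1
        rw [h2]
        calc _ ≤ _ := ContinuousLinearMap.opNorm_comp_le _ _
          _ ≤ (C * s) * (‖R‖ + 1) := by gcongr; linarith
          _ = s * (C * (‖R‖ + 1)) := by ring
          _ ≤ e := by rwa [← le_div_iff₀ (by positivity)]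
      · have h1 : ¬ InSpectrum (opL A W (ω₀ + s)) 0 := by
          rw [hiso _ (by rw [Metric.mem_ball, dist_eq_norm, hsn]; linarith)]
          simpa using hs.ne'
        obtain ⟨R', hR', -⟩ := not_not.1 h1
        obtain ⟨h, hy⟩ := hR' (-y)
        refine ⟨z • R' (-y) - A ⟨R' (-y), h⟩, ?_⟩
        rw [hTu (ω₀ + s) ⟨R' (-y), h⟩]
        rw [zero_smul, zero_sub, neg_inj] at hy
        exact hy)
    hy
  exact ⟨⟨R v, hR v⟩, by rw [← hv, hT]⟩

theorem inner_mulOp_deriv_ne_zero {W : Rd d → ℂ → ℂ} {ω₀ : ℂ} {φ₀ φs : L2 d}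
    (hD : MemLp (fun x => deriv (W x) ω₀) ∞ (volume : Measure (Rd d)))
    (h : Transversal W ω₀ φ₀ φs) : inner ℂ φs (mulOp (fun x => deriv (W x) ω₀) φ₀) ≠ 0 := by
  rw [L2.inner_def]
  refine ne_of_eq_of_ne (integral_congr_ae ?_) h
  filter_upwards [coeFn_mulOp hD φ₀] with x hx
  rw [hx, RCLike.inner_apply]

/-- The bordered linear map. It is stated on all of `L² × ℂ` by writing `D(A)` as the range of a
resolvent `R` of `A`. -/
theorem exists_bordered_equiv {A : Op d} {W : Rd d → ℂ → ℂ} {ω₀ : ℂ} {δ : ℝ} {φ₀ : A.domain}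
    {φs : L2 d} (hδ : 0 < δ) (hA : AssumptionA A) (hW : AssumptionW W ω₀ δ)
    (hsimple : AlgebraicallySimple A W ω₀ φ₀) (hisol : Isolated A W ω₀)
    (hnorm : Normalized A W ω₀ φ₀ φs) (hWt : Transversal W ω₀ φ₀ φs)
    {z : ℂ} {R : L2 d →L[ℂ] L2 d} (hR : ∀ v, R v ∈ A.domain)
    (hAR : ∀ v, z • R v - A ⟨R v, hR v⟩ = v)
    (hRA : ∀ u : A.domain, R (z • (u : L2 d) - A u) = u) :
    ∃ Λ : (L2 d × ℂ) ≃L[ℂ] (L2 d × ℂ), ∀ v μ, Λ (v, μ) =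
      (A ⟨R v, hR v⟩ - mulOp (fun x => W x ω₀) (R v) - μ • mulOp (fun x => deriv (W x) ω₀) φ₀,
        inner ℂ φs (R v)) := by
  have ht := inner_mulOp_deriv_ne_zero (hW.mulOp_expansion hδ).1 hWt
  have h0 : A φ₀ - mulOp (fun x => W x ω₀) φ₀ = 0 := (hsimple.ker φ₀).2 ⟨1, by simp⟩
  set D := mulOp (fun x => deriv (W x) ω₀) (φ₀ : L2 d) with hDdef
  set M := mulOp (fun x => W x ω₀)
  let Λ : (L2 d × ℂ) →L[ℂ] (L2 d × ℂ) :=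
    ((z • R - ContinuousLinearMap.id ℂ _ - M ∘L R) ∘L ContinuousLinearMap.fst ℂ _ _
      - (ContinuousLinearMap.snd ℂ (L2 d) ℂ).smulRight D).prod
    ((innerSL ℂ φs) ∘L R ∘L ContinuousLinearMap.fst ℂ _ _)
  have hΛ : ∀ v μ, Λ (v, μ) =
      (A ⟨R v, hR v⟩ - M (R v) - μ • D, inner ℂ φs (R v)) := fun v μ => by
    have := hAR v
    rw [sub_eq_iff_eq_add', ← sub_eq_iff_eq_add] at this
    simp [Λ, ← this]
  have hker : Λ.ker = ⊥ := by
    rw [LinearMap.ker_eq_bot']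
    rintro ⟨v, μ⟩ h
    have h : Λ (v, μ) = 0 := h
    rw [hΛ, Prod.mk_eq_zero] at h
    obtain ⟨h1, h2⟩ := h
    -- Pairing with `φs` leaves only `μ ⟨D, φs⟩ = 0`, and transversality forces `μ = 0`.
    have h3 := congrArg (fun w => inner ℂ φs w) h1
    simp only [inner_sub_right _ _ (μ • D), inner_smul_right, inner_zero_right] at h3
    rw [inner_opL_eq_zero hA hnorm ⟨R v, hR v⟩, zero_sub, neg_eq_zero] at h3
    have hμ : μ = 0 := (mul_eq_zero.1 h3).resolve_right ht
    rw [hμ, zero_smul, sub_zero] at h1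
    obtain ⟨c, hc⟩ := (hsimple.ker ⟨R v, hR v⟩).1 h1
    have hc : R v = c • (φ₀ : L2 d) := hc
    rw [hc, inner_smul_right, hnorm.inner_one, mul_one] at h2
    have h4 := hAR v
    have h5 : (⟨R v, hR v⟩ : A.domain) = 0 := Subtype.ext (hc.trans (by rw [h2, zero_smul]; rfl))
    rw [h5, hc, h2, LinearPMap.map_zero, zero_smul, smul_zero, sub_zero] at h4
    rw [← h4, hμ]; rfl
  have hran : Λ.range = ⊤ := by
    rw [LinearMap.range_eq_top]
    rintro ⟨y, s⟩
    -- The multiple of `D` makes the right-hand side orthogonal to `φs`, hence solvable. Adding a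
    -- multiple of `φ₀` below then adjusts the second component without changing the first.
    obtain ⟨u, hu⟩ := exists_opL_eq hδ hA hW hsimple hisol hnorm
      (y := y - (inner ℂ φs y / inner ℂ φs D) • D)
      (by rw [inner_sub_right, inner_smul_right, div_mul_cancel₀ _ ht, sub_self])
    set u' : A.domain := u + (s - inner ℂ φs (u : L2 d)) • φ₀ with hu'
    refine ⟨(z • (u' : L2 d) - A u', -(inner ℂ φs y / inner ℂ φs D)), ?_⟩
    have e : (⟨R (z • (u' : L2 d) - A u'), hR _⟩ : A.domain) = u' := Subtype.ext (hRA u')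
    refine (hΛ _ _).trans ?_
    rw [e, hRA]
    have e1 : A u' = A u + (s - inner ℂ φs (u : L2 d)) • A φ₀ := by
      rw [hu', LinearPMap.map_add, LinearPMap.map_smul]
    have e2 : (u' : L2 d) = u + (s - inner ℂ φs (u : L2 d)) • (φ₀ : L2 d) := rfl
    refine Prod.ext ?_ ?_
    · simp only
      rw [e1, e2, map_add, map_smul, sub_eq_zero.1 h0]
      have hu2 : A u = M u + (y - (inner ℂ φs y / inner ℂ φs D) • D) := by rw [← hu]; abel
      rw [hu2]
      module
    · simp only
      rw [e2, inner_add_right, inner_smul_right, hnorm.inner_one]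
      ring
  exact ⟨ContinuousLinearEquiv.ofBijective Λ hker hran, hΛ⟩

/-! ### The nonlinearity -/

/-- The class in `L²` of a function (and `0` if the function is not in `L²`). -/
def toL2 (h : Rd d → ℂ) : L2 d :=
  open Classical in if hh : MemLp h 2 volume then hh.toLp h else 0

theorem coeFn_toL2 {h : Rd d → ℂ} (hh : MemLp h 2 volume) : toL2 h =ᵐ[volume] h := by
  rw [toL2, dif_pos hh]
  exact hh.coeFn_toLp

theorem norm_toL2_sub_le {h₁ h₂ : Rd d → ℂ} (m₁ : MemLp h₁ 2 volume) (m₂ : MemLp h₂ 2 volume)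
    {c : ℝ} (hc : 0 ≤ c) (h : eLpNorm (fun x => h₁ x - h₂ x) 2 volume ≤ ENNReal.ofReal c) :
    ‖toL2 h₁ - toL2 h₂‖ ≤ c := by
  rw [toL2, toL2, dif_pos m₁, dif_pos m₂, ← MemLp.toLp_sub, Lp.norm_toLp]
  exact ENNReal.toReal_le_of_le_ofReal hc h

/-- The superposition operator `u ↦ f(·, ω, u)`. -/
def superposition (f : Rd d → ℂ → ℂ → ℂ) (ω : ℂ) (u : L2 d) : L2 d := toL2 fun x => f x ω (u x)

theorem solves_iff {A : Op d} {W : Rd d → ℂ → ℂ} {f : Rd d → ℂ → ℂ → ℂ} {ω : ℂ} {φ : A.domain}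
    (hW : MemLp (fun x => W x ω) ∞ volume)
    (hf : MemLp (fun x => f x ω ((φ : L2 d) x)) 2 volume) :
    Solves A W f ω φ ↔ A φ - mulOp (fun x => W x ω) φ = superposition f ω φ := by
  rw [Solves, Lp.ext_iff]
  refine Filter.eventually_congr ?_
  filter_upwards [coeFn_mulOp hW φ, coeFn_toL2 hf,
    Lp.coeFn_sub (A φ) (mulOp (fun x => W x ω) φ)] with x h1 h2 h3
  rw [h3, Pi.sub_apply, h1, superposition, h2]

theorem PT_superposition {A : Op d} {W : Rd d → ℂ → ℂ} {f : Rd d → ℂ → ℂ → ℂ} {g : ℂ → Rd d → ℂ}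
    {ω₀ δ : ℝ} (hPT : PTSymmetricProblem A W f g ω₀ δ) {ω : ℝ} (hω : |ω - ω₀| < δ) {u : A.domain}
    (hu : graphNorm A u < δ) (hf : MemLp (fun x => f x ω ((u : L2 d) x)) 2 volume)
    (hsym : PT (u : L2 d) = u) : PT (superposition f ω u) = superposition f ω u := by
  apply Lp.ext
  filter_upwards [coeFn_PT (superposition f ω u), coeFn_toL2 hf, ae_comp_neg (coeFn_toL2 hf),
    hPT.nonlinearity ω hω u hu] with x h1 h2 h3 h4
  rw [hsym] at h4
  rw [h1, superposition, h2, h3, h4]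

/-! ### Graph norm estimates and rescaling of the nonlinearity -/

theorem graphNorm_add_le (A : Op d) (u v : A.domain) :
    graphNorm A (u + v) ≤ graphNorm A u + graphNorm A v := by
  rw [graphNorm, graphNorm, graphNorm, LinearPMap.map_add, Submodule.coe_add]
  linarith [norm_add_le (u : L2 d) v, norm_add_le (A u) (A v)]

theorem graphNorm_smul (A : Op d) (c : ℂ) (u : A.domain) :
    graphNorm A (c • u) = ‖c‖ * graphNorm A u := by
  rw [graphNorm, graphNorm, LinearPMap.map_smul, Submodule.coe_smul, norm_smul, norm_smul, mul_add]

theorem graphNorm_nonneg (A : Op d) (u : A.domain) : 0 ≤ graphNorm A u := by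
  rw [graphNorm]; positivity

theorem AssumptionA.ae_bounded {A : Op d} (hA : AssumptionA A) (u : A.domain) :
    ∃ B : ℝ, 0 < B ∧ ∀ᵐ x, ‖(u : L2 d) x‖ ≤ B := by
  obtain ⟨C, hC⟩ := hA.embedding
  refine ⟨max (C * graphNorm A u) 0 + 1, by positivity, ?_⟩
  have h := hC u
  rw [eLpNorm_exponent_top] at h
  filter_upwards [ae_le_eLpNormEssSup (f := (u : L2 d)) (μ := volume)] with x hx
  have h1 : ENNReal.ofReal ‖(u : L2 d) x‖ ≤ ENNReal.ofReal (max (C * graphNorm A u) 0) := by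
    rw [ofReal_norm]
    exact (hx.trans h).trans (ENNReal.ofReal_le_ofReal (le_max_left _ _))
  rw [ENNReal.ofReal_le_ofReal_iff (le_max_right _ _)] at h1
  linarith

theorem exists_rpow_lt {α t : ℝ} (hα : 0 < α) (ht : 0 < t) :
    ∃ ε₁ : ℝ, 0 < ε₁ ∧ ε₁ ≤ 1 ∧ ∀ ε ∈ Ioo 0 ε₁, ε ^ α < t := by
  refine ⟨min 1 (t ^ α⁻¹), lt_min one_pos (by positivity), min_le_left _ _, fun ε hε => ?_⟩
  have := Real.rpow_lt_rpow hε.1.le (hε.2.trans_le (min_le_right _ _)) hα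
  rwa [Real.rpow_inv_rpow ht.le hα.ne'] at this

theorem rpow_rpow_one_div_add {ε α : ℝ} (hε : 0 < ε) (hα : 0 < α) (s : ℝ) :
    (ε ^ α) ^ (1 / α + 1 + s) = ε ^ α * (ε * ε ^ (α * s)) := by
  rw [← Real.rpow_mul hε.le]
  have : α * (1 / α + 1 + s) = α + (1 + α * s) := by field_simp; ring
  rw [this, Real.rpow_add hε, Real.rpow_add hε, Real.rpow_one]

/-- The leading order term `g |u|^{1/α} u` of the nonlinearity. -/
def leadingTerm (g : Rd d → ℂ) (α : ℝ) (u : L2 d) : L2 d :=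
  toL2 fun x => g x * ((‖u x‖ ^ (1 / α) : ℝ) : ℂ) * u x

theorem memLp_leadingTerm {g : Rd d → ℂ} {α B : ℝ} (hα : 0 < α) (hg : MemLp g ∞ volume)
    {u : L2 d} (hu : ∀ᵐ x, ‖u x‖ ≤ B) :
    MemLp (fun x => g x * ((‖u x‖ ^ (1 / α) : ℝ) : ℂ) * u x) 2 volume := by
  have hp : MemLp (fun x => ((‖u x‖ ^ (1 / α) : ℝ) : ℂ)) ∞ (volume : Measure (Rd d)) := by
    refine memLp_top_of_bound ?_ (B ^ (1 / α)) ?_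
    · have hc : Continuous fun w : ℂ => ((‖w‖ ^ (1 / α) : ℝ) : ℂ) :=
        Complex.continuous_ofReal.comp
          (continuous_norm.rpow_const fun _ => Or.inr (by positivity))
      exact hc.comp_aestronglyMeasurable (Lp.aestronglyMeasurable u)
    · filter_upwards [hu] with x hx
      rw [Complex.norm_real, Real.norm_of_nonneg (by positivity)]
      gcongr
  exact (Lp.memLp u).mul (hp.mul hg (r := ∞)) (r := 2)

/-- The rescaled nonlinearity `ε^{-α} f(·, ω, ε^α u)` is Lipschitz of order `ε` near `φ₀`, and
equals `ε g |φ₀|^{1/α} φ₀` up to `O(ε^{1+τ})` at `φ₀`. -/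
theorem AssumptionF.rescaled {A : Op d} {ω₀ : ℂ} {φ₀ : A.domain} {δ α β τ : ℝ}
    {f : Rd d → ℂ → ℂ → ℂ} {g : ℂ → Rd d → ℂ} (hA : AssumptionA A) (hδ : 0 < δ) (hα : 0 < α)
    (hτ : τ ≤ α * β) (hβ : 0 < β) (hf : AssumptionF A ω₀ φ₀ δ α β f g) :
    ∃ K ε₁ : ℝ, 0 < K ∧ 0 < ε₁ ∧ ∀ ε ∈ Ioo 0 ε₁,
      (∀ u : A.domain, graphNorm A (u - φ₀) < δ → graphNorm A (((ε ^ α : ℝ) : ℂ) • u) < δ) ∧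
      (∀ ω₁ ∈ Metric.ball ω₀ δ, ∀ ω₂ ∈ Metric.ball ω₀ δ, ∀ u₁ u₂ : A.domain,
        graphNorm A (u₁ - φ₀) < δ → graphNorm A (u₂ - φ₀) < δ →
        ‖(((ε ^ α : ℝ) : ℂ))⁻¹ • superposition f ω₁ (((ε ^ α : ℝ) : ℂ) • u₁)
          - (((ε ^ α : ℝ) : ℂ))⁻¹ • superposition f ω₂ (((ε ^ α : ℝ) : ℂ) • u₂)‖
          ≤ K * ε * (‖ω₁ - ω₂‖ + ‖(u₁ : L2 d) - u₂‖)) ∧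
      ‖(((ε ^ α : ℝ) : ℂ))⁻¹ • superposition f ω₀ (((ε ^ α : ℝ) : ℂ) • φ₀)
        - (ε : ℂ) • leadingTerm (g ω₀) α φ₀‖ ≤ K * ε ^ (1 + τ) := by
  obtain ⟨l₀, hl₀, K, hK⟩ := hf.lipschitz
  obtain ⟨C, s, hs, hC⟩ := hf.asymptotics
  obtain ⟨B, hB, hφB⟩ := hA.ae_bounded φ₀
  have hN := graphNorm_nonneg A φ₀
  -- The three thresholds for `ε^α` serve the Lipschitz hypothesis, the asymptotics (`ε^α |φ₀| < s`
  -- a.e.), and membership of `ε^α u` in the ball where `f` maps into `L²`.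
  obtain ⟨ε₁, hε₁, hε₁1, hlt⟩ := exists_rpow_lt hα
    (t := min l₀ (min (s / B) (δ / (δ + graphNorm A φ₀)))) (by positivity)
  refine ⟨max (|K| + 1) (|C| * B ^ (1 / α + β) * ‖(φ₀ : L2 d)‖), ε₁,
    lt_max_of_lt_left (by positivity), hε₁, fun ε hε => ?_⟩
  have hε0 := hε.1
  have hε1 : ε ≤ 1 := hε.2.le.trans hε₁1
  set l := ε ^ α with hl
  have hl0 : 0 < l := by positivity
  have hl1 : l < l₀ := (hlt ε hε).trans_le (min_le_left _ _)
  have hl2 : l < s / B := (hlt ε hε).trans_le ((min_le_right _ _).trans (min_le_left _ _))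
  have hl3 : l < δ / (δ + graphNorm A φ₀) :=
    (hlt ε hε).trans_le ((min_le_right _ _).trans (min_le_right _ _))
  have hnl : ‖(l : ℂ)‖ = l := by rw [Complex.norm_real, Real.norm_of_nonneg hl0.le]
  have hlpow : l ^ (1 / α + 1) = l * ε := by
    have := rpow_rpow_one_div_add hε0 hα 0
    simpa using this
  have hsmall : ∀ u : A.domain, graphNorm A (u - φ₀) < δ → graphNorm A ((l : ℂ) • u) < δ := by
    intro u hu
    have h1 := graphNorm_add_le A (u - φ₀) φ₀
    rw [sub_add_cancel] at h1
    rw [graphNorm_smul, hnl]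
    rw [lt_div_iff₀ (by positivity)] at hl3
    nlinarith
  have hmem : ∀ ω ∈ Metric.ball ω₀ δ, ∀ u : A.domain, graphNorm A (u - φ₀) < δ →
      MemLp (fun x => f x ω (((l : ℂ) • (u : L2 d) : L2 d) x)) 2 volume := fun ω hω u hu =>
    hf.memL2 ω hω ((l : ℂ) • u) (hsmall u hu)
  have hscale : ∀ p q : L2 d, ∀ c, ‖p - q‖ ≤ l * c → ‖(l : ℂ)⁻¹ • p - (l : ℂ)⁻¹ • q‖ ≤ c := by
    intro p q c h
    rw [← smul_sub, norm_smul, norm_inv, hnl, inv_mul_le_iff₀ hl0]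
    exact h
  refine ⟨hsmall, fun ω₁ h₁ ω₂ h₂ u₁ u₂ hu₁ hu₂ => ?_, ?_⟩
  · obtain ⟨hKω, hKu⟩ := hK l ⟨hl0, hl1⟩
    apply hscale
    have e1 : ‖superposition f ω₁ ((l : ℂ) • (u₁ : L2 d)) - superposition f ω₂ ((l : ℂ) • (u₁ : L2 d))‖
        ≤ |K| * (l * ε) * ‖ω₁ - ω₂‖ := by
      refine norm_toL2_sub_le (hmem ω₁ h₁ u₁ hu₁) (hmem ω₂ h₂ u₁ hu₁) (by positivity) ?_
      refine le_trans (le_of_eq (eLpNorm_congr_ae ?_)) ((hKω ω₁ h₁ ω₂ h₂ u₁ hu₁).trans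
        (ENNReal.ofReal_le_ofReal ?_))
      · filter_upwards [Lp.coeFn_smul (l : ℂ) (u₁ : L2 d)] with x hx
        rw [hx, Pi.smul_apply, smul_eq_mul]
      · rw [hlpow]; gcongr; exact le_abs_self K
    have e2 : ‖superposition f ω₂ ((l : ℂ) • (u₁ : L2 d)) - superposition f ω₂ ((l : ℂ) • (u₂ : L2 d))‖
        ≤ |K| * (l * ε) * ‖(u₁ : L2 d) - u₂‖ := by
      refine norm_toL2_sub_le (hmem ω₂ h₂ u₁ hu₁) (hmem ω₂ h₂ u₂ hu₂) (by positivity) ?_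
      refine le_trans (le_of_eq (eLpNorm_congr_ae ?_)) ((hKu ω₂ h₂ u₁ u₂ hu₁ hu₂).trans
        (ENNReal.ofReal_le_ofReal ?_))
      · filter_upwards [Lp.coeFn_smul (l : ℂ) (u₁ : L2 d), Lp.coeFn_smul (l : ℂ) (u₂ : L2 d)]
          with x hx hx2
        rw [hx, hx2, Pi.smul_apply, Pi.smul_apply, smul_eq_mul, smul_eq_mul]
      · rw [hlpow]; gcongr; exact le_abs_self K
    calc _ ≤ _ := norm_sub_le_norm_sub_add_norm_sub _
          (superposition f ω₂ ((l : ℂ) • (u₁ : L2 d))) _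
      _ ≤ |K| * (l * ε) * ‖ω₁ - ω₂‖ + |K| * (l * ε) * ‖(u₁ : L2 d) - u₂‖ := add_le_add e1 e2
      _ = l * (|K| * ε * (‖ω₁ - ω₂‖ + ‖(u₁ : L2 d) - u₂‖)) := by ring
      _ ≤ _ := by
        gcongr
        exact (by linarith : |K| ≤ |K| + 1).trans (le_max_left _ _)
  · have hω₀ : ω₀ ∈ Metric.ball ω₀ δ := Metric.mem_ball_self hδ
    have hmem₀ := hmem ω₀ hω₀ φ₀ (by
      rw [sub_self, graphNorm, LinearPMap.map_zero]; simpa using hδ)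
    have hlead := memLp_leadingTerm hα (hf.g_mem ω₀ hω₀).1 hφB
    have e : ((ε : ℝ) : ℂ) • leadingTerm (g ω₀) α φ₀
        = (l : ℂ)⁻¹ • ((l * ε : ℝ) : ℂ) • leadingTerm (g ω₀) α φ₀ := by
      rw [smul_smul, Complex.ofReal_mul, inv_mul_cancel_left₀ (by exact_mod_cast hl0.ne')]
    rw [e]
    apply hscale
    have hb : ‖superposition f ω₀ ((l : ℂ) • (φ₀ : L2 d))
        - ((l * ε : ℝ) : ℂ) • leadingTerm (g ω₀) α φ₀‖
        ≤ |C| * ((l * (ε * ε ^ (α * β))) * B ^ (1 / α + β)) * ‖(φ₀ : L2 d)‖ := by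
      apply Lp.norm_le_mul_norm_of_ae_le_mul
      filter_upwards [Lp.coeFn_sub (superposition f ω₀ ((l : ℂ) • (φ₀ : L2 d)))
          (((l * ε : ℝ) : ℂ) • leadingTerm (g ω₀) α φ₀),
        Lp.coeFn_smul ((l * ε : ℝ) : ℂ) (leadingTerm (g ω₀) α φ₀), coeFn_toL2 hmem₀,
        coeFn_toL2 hlead, Lp.coeFn_smul (l : ℂ) (φ₀ : L2 d), hφB, hC ω₀ hω₀]
        with x h1 h2 h3 h4 h5 h6 h7
      rw [h1, Pi.sub_apply, h2, Pi.smul_apply, superposition, h3, leadingTerm, h4, h5, Pi.smul_apply,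
        smul_eq_mul, smul_eq_mul]
      set w := (φ₀ : L2 d) x
      have hnw : ‖(l : ℂ) * w‖ = l * ‖w‖ := by rw [norm_mul, hnl]
      have h8 := h7 ((l : ℂ) * w) (by
        rw [hnw]
        rw [lt_div_iff₀ hB] at hl2
        exact (by gcongr : l * ‖w‖ ≤ l * B).trans_lt hl2)
      have h9 : ((l * ε : ℝ) : ℂ) * (g ω₀ x * ((‖w‖ ^ (1 / α) : ℝ) : ℂ) * w)
          = g ω₀ x * ((‖(l : ℂ) * w‖ ^ (1 / α) : ℝ) : ℂ) * ((l : ℂ) * w) := by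
        have : l ^ (1 / α) = ε := by
          rw [hl, ← Real.rpow_mul hε0.le, mul_one_div_cancel hα.ne', Real.rpow_one]
        rw [hnw, Real.mul_rpow hl0.le (norm_nonneg _), this]
        push_cast
        ring
      rw [h9]
      refine h8.trans ?_
      rw [hnw, Real.mul_rpow hl0.le (norm_nonneg _), hl, rpow_rpow_one_div_add hε0 hα β]
      -- One factor `‖w‖` is kept so that the pointwise bound is square integrable; the other powers
      -- are bounded through `φ₀ ∈ L^∞`.
      have h10 : ‖w‖ ^ (1 / α + 1 + β) ≤ B ^ (1 / α + β) * ‖w‖ := by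
        have : 1 / α + 1 + β = (1 / α + β) + 1 := by ring
        rw [this, Real.rpow_add_one' (norm_nonneg _) (by positivity)]
        gcongr
      calc C * (ε ^ α * (ε * ε ^ (α * β)) * ‖w‖ ^ (1 / α + 1 + β))
          ≤ |C| * (ε ^ α * (ε * ε ^ (α * β)) * (B ^ (1 / α + β) * ‖w‖)) := by
            gcongr
            exact le_abs_self C
        _ = _ := by ring
    refine hb.trans ?_
    have h11 : ε ^ (α * β) ≤ ε ^ τ := Real.rpow_le_rpow_of_exponent_ge hε0 hε1 hτ
    rw [Real.rpow_add hε0, Real.rpow_one]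
    calc |C| * ((l * (ε * ε ^ (α * β))) * B ^ (1 / α + β)) * ‖(φ₀ : L2 d)‖
        ≤ |C| * ((l * (ε * ε ^ τ)) * B ^ (1 / α + β)) * ‖(φ₀ : L2 d)‖ := by gcongr
      _ = l * ((|C| * B ^ (1 / α + β) * ‖(φ₀ : L2 d)‖) * (ε * ε ^ τ)) := by ring
      _ ≤ _ := by gcongr; exact le_max_right _ _

/-! ### Symmetry of the linear problem -/

theorem PT_opL {A : Op d} {W : Rd d → ℂ → ℂ} {f : Rd d → ℂ → ℂ → ℂ} {g : ℂ → Rd d → ℂ}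
    {ω₀ δ : ℝ} (hδ : 0 < δ) (hW : AssumptionW W ω₀ δ) (hPT : PTSymmetricProblem A W f g ω₀ δ)
    (u : A.domain) : ∃ h : PT (u : L2 d) ∈ A.domain,
      A ⟨PT u, h⟩ - mulOp (fun x => W x ω₀) (PT u)
        = PT (A u - mulOp (fun x => W x ω₀) u) := by
  obtain ⟨h, e⟩ := hPT.opA u
  obtain ⟨c, hc⟩ := hW.bounded
  refine ⟨h, ?_⟩
  rw [e, PT_sub, PT_mulOp (hc ω₀ (Metric.mem_ball_self hδ)).1 (hPT.potential ω₀ (by simpa using hδ))]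

/-- The kernel is a `ℬ`-invariant line and `ℬ` is isometric, so `ℬ φ₀ = a φ₀` with `|a| = 1`. A
square root `c` of `a` works, because `conj c * c² = c`. -/
theorem exists_phase_PT_eq {A : Op d} {W : Rd d → ℂ → ℂ} {f : Rd d → ℂ → ℂ → ℂ}
    {g : ℂ → Rd d → ℂ} {ω₀ δ : ℝ} {φ₀ : A.domain} (hδ : 0 < δ) (hW : AssumptionW W ω₀ δ)
    (hPT : PTSymmetricProblem A W f g ω₀ δ) (hsimple : AlgebraicallySimple A W ω₀ φ₀)
    (h1 : ‖(φ₀ : L2 d)‖ = 1) :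
    ∃ c : ℂ, ‖c‖ = 1 ∧ PT (c • (φ₀ : L2 d)) = c • (φ₀ : L2 d) := by
  have h0 : A φ₀ - mulOp (fun x => W x ω₀) φ₀ = 0 := (hsimple.ker φ₀).2 ⟨1, by simp⟩
  obtain ⟨h, e⟩ := PT_opL hδ hW hPT φ₀
  rw [h0, PT_zero] at e
  obtain ⟨a, ha⟩ := (hsimple.ker ⟨PT φ₀, h⟩).1 e
  have ha : PT (φ₀ : L2 d) = a • (φ₀ : L2 d) := ha
  have ha1 : ‖a‖ = 1 := by
    have := congrArg norm ha
    rwa [norm_PT, norm_smul, h1, mul_one, eq_comm] at this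
  obtain ⟨c, hc⟩ := IsAlgClosed.exists_pow_nat_eq a two_pos
  have hc1 : ‖c‖ = 1 := by
    rw [← hc, norm_pow] at ha1
    exact (pow_eq_one_iff_of_nonneg (norm_nonneg c) two_ne_zero).1 ha1
  refine ⟨c, hc1, ?_⟩
  rw [PT_smul, ha, smul_smul]
  congr 1
  rw [← hc, pow_two, ← mul_assoc, Complex.conj_mul', hc1]
  simp

/-- Symmetry of `W` is assumed only at real parameters, so it passes to the derivative through real
difference quotients. -/
theorem PT_mulOp_deriv {A : Op d} {W : Rd d → ℂ → ℂ} {f : Rd d → ℂ → ℂ → ℂ}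
    {g : ℂ → Rd d → ℂ} {ω₀ δ : ℝ} (hδ : 0 < δ) (hW : AssumptionW W ω₀ δ)
    (hPT : PTSymmetricProblem A W f g ω₀ δ) (u : L2 d) :
    PT (mulOp (fun x => deriv (W x) ω₀) u) = mulOp (fun x => deriv (W x) ω₀) (PT u) := by
  obtain ⟨-, C, hC, hexp⟩ := hW.mulOp_expansion hδ
  obtain ⟨_, hm⟩ := hW.bounded
  set D := mulOp (fun x => deriv (W x) (ω₀ : ℂ))
  have hbound : ∀ s : ℝ, 0 < s → s ≤ δ / 4 → ‖D (PT u) - PT (D u)‖ ≤ 2 * C * ‖u‖ * s := by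
    intro s hs hs4
    have hsn : ‖((ω₀ + s : ℝ) : ℂ) - ω₀‖ = s := by
      rw [← Complex.ofReal_sub, add_sub_cancel_left, Complex.norm_real, Real.norm_of_nonneg hs.le]
    have h1 := hexp s hs4 ((ω₀ + s : ℝ) : ℂ)
      (by rw [Metric.mem_closedBall, dist_eq_norm, hsn]) ω₀ (Metric.mem_closedBall_self hs.le)
    have hps : ∀ v, PT (mulOp (fun x => W x ((ω₀ + s : ℝ) : ℂ)) v)
        = mulOp (fun x => W x ((ω₀ + s : ℝ) : ℂ)) (PT v) := PT_mulOp
      (hm _ (by rw [Metric.mem_ball, dist_eq_norm, hsn]; linarith)).1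
      (hPT.potential _ (by rw [add_sub_cancel_left, abs_of_pos hs]; linarith))
    have hp0 : ∀ v, PT (mulOp (fun x => W x (ω₀ : ℂ)) v)
        = mulOp (fun x => W x (ω₀ : ℂ)) (PT v) := PT_mulOp
      (hm _ (Metric.mem_ball_self hδ)).1 (hPT.potential _ (by simpa using hδ))
    rw [hsn] at h1
    have hω : ((ω₀ + s : ℝ) : ℂ) - ω₀ = s := by push_cast; ring
    rw [hω] at h1
    set Ms := mulOp (fun x => W x ((ω₀ + s : ℝ) : ℂ))
    set M := mulOp (fun x => W x (ω₀ : ℂ))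
    -- The potentials at `ω₀` and `ω₀ + s` commute with `ℬ`, so only the `O(s²)` Taylor remainder
    -- contributes to the commutator.
    have key : (s : ℂ) • (D (PT u) - PT (D u))
        = PT ((Ms - M - (s : ℂ) • D) u) - (Ms - M - (s : ℂ) • D) (PT u) := by
      simp only [sub_apply, smul_apply, PT_sub, PT_smul, hps, hp0, Complex.conj_ofReal]
      module
    have h2 : s * ‖D (PT u) - PT (D u)‖ ≤ s * (2 * C * ‖u‖ * s) := by
      calc s * ‖D (PT u) - PT (D u)‖ = ‖(s : ℂ) • (D (PT u) - PT (D u))‖ := by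
            rw [norm_smul, Complex.norm_real, Real.norm_of_nonneg hs.le]
        _ ≤ ‖(Ms - M - (s : ℂ) • D) u‖ + ‖(Ms - M - (s : ℂ) • D) (PT u)‖ := by
            rw [key, ← norm_PT ((Ms - M - (s : ℂ) • D) u)]; exact norm_sub_le _ _
        _ ≤ C * s * s * ‖u‖ + C * s * s * ‖PT u‖ := by
            gcongr <;> exact ContinuousLinearMap.le_of_opNorm_le _ h1 _
        _ = s * (2 * C * ‖u‖ * s) := by rw [norm_PT]; ring
    exact le_of_mul_le_mul_left h2 hs
  have hlim : Filter.Tendsto (fun s : ℝ => 2 * C * ‖u‖ * s) (nhdsWithin 0 (Ioi 0)) (nhds 0) := by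
    have : Filter.Tendsto (fun s : ℝ => 2 * C * ‖u‖ * s) (nhds 0) (nhds (2 * C * ‖u‖ * 0)) :=
      (continuous_const.mul continuous_id).tendsto 0
    rw [mul_zero] at this
    exact this.mono_left nhdsWithin_le_nhds
  have h0 : ‖D (PT u) - PT (D u)‖ ≤ 0 := by
    refine ge_of_tendsto hlim ?_
    filter_upwards [Ioo_mem_nhdsGT (by positivity : (0 : ℝ) < δ / 4)] with s hs
    exact hbound s hs.1 hs.2.le
  exact (sub_eq_zero.1 (norm_le_zero_iff.1 h0)).symm

/-- Solutions of the bordered linear problem with symmetric right-hand side are symmetric. -/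
theorem symmetric_of_bordered {A : Op d} {W : Rd d → ℂ → ℂ} {f : Rd d → ℂ → ℂ → ℂ}
    {g : ℂ → Rd d → ℂ} {ω₀ δ : ℝ} {φ₀ : A.domain} {φs : L2 d}
    (hδ : 0 < δ) (hA : AssumptionA A) (hW : AssumptionW W ω₀ δ)
    (hsimple : AlgebraicallySimple A W ω₀ φ₀) (hisol : Isolated A W ω₀)
    (hnorm : Normalized A W ω₀ φ₀ φs) (hWt : Transversal W ω₀ φ₀ φs)
    (hPT : PTSymmetricProblem A W f g ω₀ δ) (hφ₀ : PT (φ₀ : L2 d) = φ₀)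
    {y : L2 d} (hy : PT y = y) {u : A.domain} {μ : ℂ}
    (hu : A u - mulOp (fun x => W x ω₀) u - μ • mulOp (fun x => deriv (W x) ω₀) φ₀ = y)
    (hφs : inner ℂ φs (u : L2 d) = 0) : PT (u : L2 d) = u ∧ μ.im = 0 := by
  obtain ⟨h, e⟩ := PT_opL hδ hW hPT u
  -- No symmetry of `φs` is needed: its orthogonal complement is `ran L(ω₀)`, which `ℬ` preserves.
  have hφs' : inner ℂ φs (PT (u : L2 d)) = 0 := by
    obtain ⟨w, hw⟩ := exists_opL_eq hδ hA hW hsimple hisol hnorm hφs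
    obtain ⟨h', e'⟩ := PT_opL hδ hW hPT w
    rw [← hw, ← e']
    exact inner_opL_eq_zero hA hnorm ⟨PT w, h'⟩
  have ht := inner_mulOp_deriv_ne_zero (hW.mulOp_expansion hδ).1 hWt
  have hD := PT_mulOp_deriv hδ hW hPT (φ₀ : L2 d)
  rw [hφ₀] at hD
  set D := mulOp (fun x => deriv (W x) ω₀) (φ₀ : L2 d)
  set M := mulOp (fun x => W x (ω₀ : ℂ))
  -- `(ℬ u, conj μ)` solves the same bordered problem as `(u, μ)`; the rest is uniqueness for that
  -- problem.
  have hu' : A ⟨PT u, h⟩ - M (PT u) - conj μ • D = y := by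
    rw [e, ← hD, ← PT_smul, ← PT_sub, hu, hy]
  have hμ : conj μ = μ := by
    have h1 := congrArg (fun w => inner ℂ φs w) (hu'.trans hu.symm)
    simp only [inner_sub_right _ _ (_ • D), inner_smul_right] at h1
    rw [inner_opL_eq_zero hA hnorm ⟨PT u, h⟩, inner_opL_eq_zero hA hnorm u, zero_sub, zero_sub,
      neg_inj] at h1
    exact mul_right_cancel₀ ht h1
  refine ⟨?_, Complex.conj_eq_iff_im.1 hμ⟩
  have h2 : A ⟨PT u, h⟩ - M (PT u) = A u - M u := by
    rw [hμ] at hu'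
    exact sub_left_injective (hu'.trans hu.symm)
  obtain ⟨c, hc⟩ := (hsimple.ker (⟨PT u, h⟩ - u : A.domain)).1 (by
    have : A (⟨PT u, h⟩ - u : A.domain) - M (PT (u : L2 d) - u) = 0 := by
      rw [LinearPMap.map_sub, map_sub, sub_sub_sub_comm, h2, sub_self]
    exact this)
  have hc : PT (u : L2 d) - u = c • (φ₀ : L2 d) := hc
  have h3 := congrArg (fun w => inner ℂ φs w) hc
  simp only [inner_sub_right, inner_smul_right, hφs, hφs', hnorm.inner_one] at h3
  rw [← sub_eq_zero, hc]
  rw [sub_zero, mul_one] at h3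
  rw [← h3, zero_smul]

/-! ### The reduced problem -/

/-- The nonlinear part of the problem for `φ = ε^α (φ₀ + R v)`, `ω = ω₀ + μ`. -/
def reducedMap (W : Rd d → ℂ → ℂ) (f : Rd d → ℂ → ℂ → ℂ) (ω₀ : ℂ) (φ₀ : L2 d) (α : ℝ)
    (R : L2 d →L[ℂ] L2 d) (ε : ℝ) (p : L2 d × ℂ) : L2 d :=
  (mulOp (fun x => W x (ω₀ + p.2)) - mulOp (fun x => W x ω₀)) (φ₀ + R p.1)
    - p.2 • mulOp (fun x => deriv (W x) ω₀) φ₀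
    + ((ε ^ α : ℝ) : ℂ)⁻¹ • superposition f (ω₀ + p.2) (((ε ^ α : ℝ) : ℂ) • (φ₀ + R p.1))

theorem norm_linear_remainder_sub_le {W : Rd d → ℂ → ℂ} {ω₀ : ℂ} {δ : ℝ} (hδ : 0 < δ)
    (hW : AssumptionW W ω₀ δ) (φ₀ : L2 d) (R : L2 d →L[ℂ] L2 d) :
    ∃ κ : ℝ, 0 < κ ∧ ∀ ρ ≤ min 1 (δ / 4), ∀ p q : L2 d × ℂ, ‖p‖ ≤ ρ → ‖q‖ ≤ ρ →
      ‖((mulOp (fun x => W x (ω₀ + p.2)) - mulOp (fun x => W x ω₀)) (φ₀ + R p.1)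
          - p.2 • mulOp (fun x => deriv (W x) ω₀) φ₀)
        - ((mulOp (fun x => W x (ω₀ + q.2)) - mulOp (fun x => W x ω₀)) (φ₀ + R q.1)
          - q.2 • mulOp (fun x => deriv (W x) ω₀) φ₀)‖ ≤ κ * ρ * ‖p - q‖ := by
  obtain ⟨-, C, hC, hexp⟩ := hW.mulOp_expansion hδ
  obtain ⟨L, hL, hlip⟩ := hW.mulOp_lipschitz hδ
  set D := mulOp (fun x => deriv (W x) ω₀)
  refine ⟨C * (‖φ₀‖ + ‖R‖) + ‖D‖ * ‖R‖ + L * ‖R‖ + 1, by positivity, ?_⟩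
  rintro ρ hρ ⟨v, μ⟩ ⟨v', μ'⟩ hp hq
  have hρ0 : 0 ≤ ρ := (norm_nonneg _).trans hp
  have hρ1 : ρ ≤ 1 := hρ.trans (min_le_left _ _)
  have hρ2 : ρ ≤ δ / 4 := hρ.trans (min_le_right _ _)
  have hv : ‖v‖ ≤ ρ := (norm_fst_le (v, μ)).trans hp
  have hμ : ‖μ‖ ≤ ρ := (norm_snd_le (v, μ)).trans hp
  have hμ' : ‖μ'‖ ≤ ρ := (norm_snd_le (v', μ')).trans hq
  have hvv : ‖v - v'‖ ≤ ‖((v, μ) : L2 d × ℂ) - (v', μ')‖ := norm_fst_le ((v, μ) - (v', μ'))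
  have hμμ : ‖μ - μ'‖ ≤ ‖((v, μ) : L2 d × ℂ) - (v', μ')‖ := norm_snd_le ((v, μ) - (v', μ'))
  set n := ‖((v, μ) : L2 d × ℂ) - (v', μ')‖
  have h1 := hexp ρ hρ2 (ω₀ + μ) (by simpa [dist_eq_norm] using hμ) (ω₀ + μ')
    (by simpa [dist_eq_norm] using hμ')
  have h2 := hlip (ω₀ + μ') (by simpa [dist_eq_norm] using hμ'.trans hρ2)
  rw [add_sub_add_left_eq_sub] at h1
  rw [add_sub_cancel_left] at h2
  simp only
  set Mμ := mulOp (fun x => W x (ω₀ + μ))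
  set Mμ' := mulOp (fun x => W x (ω₀ + μ'))
  set M := mulOp (fun x => W x ω₀)
  -- Each of the three terms carries a factor `O(ρ)`: the first from strict differentiability of the
  -- potential, the second from `‖R v‖`, the third from `‖μ'‖`.
  have key : ((Mμ - M) (φ₀ + R v) - μ • D φ₀) - ((Mμ' - M) (φ₀ + R v') - μ' • D φ₀)
      = (Mμ - Mμ' - (μ - μ') • D) (φ₀ + R v) + (μ - μ') • D (R v) + (Mμ' - M) (R (v - v')) := by
    simp only [sub_apply, smul_apply, map_add, map_sub]
    module
  have hRv : ‖R v‖ ≤ ‖R‖ * ρ := (R.le_opNorm v).trans (by gcongr)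
  have a1 : ‖(Mμ - Mμ' - (μ - μ') • D) (φ₀ + R v)‖ ≤ (C * ρ * n) * (‖φ₀‖ + ‖R‖) := by
    refine (ContinuousLinearMap.le_of_opNorm_le _ h1 _).trans ?_
    gcongr
    refine (norm_add_le _ _).trans ?_
    gcongr
    exact hRv.trans (mul_le_of_le_one_right (norm_nonneg _) hρ1)
  have a2 : ‖(μ - μ') • D (R v)‖ ≤ n * (‖D‖ * (‖R‖ * ρ)) := by
    rw [norm_smul]
    gcongr
    exact (D.le_opNorm _).trans (by gcongr)
  have a3 : ‖(Mμ' - M) (R (v - v'))‖ ≤ (L * ρ) * (‖R‖ * n) := by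
    refine (ContinuousLinearMap.le_of_opNorm_le _ h2 _).trans ?_
    gcongr
    exact (R.le_opNorm _).trans (by gcongr)
  rw [key]
  calc _ ≤ _ := norm_add₃_le
    _ ≤ (C * ρ * n) * (‖φ₀‖ + ‖R‖) + n * (‖D‖ * (‖R‖ * ρ)) + (L * ρ) * (‖R‖ * n) := by gcongr
    _ ≤ (C * (‖φ₀‖ + ‖R‖) + ‖D‖ * ‖R‖ + L * ‖R‖ + 1) * ρ * n := by
      have : 0 ≤ ρ * n := by positivity
      linarith

theorem graphNorm_resolvent_le {A : Op d} {z : ℂ} {R : L2 d →L[ℂ] L2 d} (hR : ∀ v, R v ∈ A.domain)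
    (hAR : ∀ v, z • R v - A ⟨R v, hR v⟩ = v) (v : L2 d) :
    graphNorm A ⟨R v, hR v⟩ ≤ (‖R‖ + ‖z‖ * ‖R‖ + 1) * ‖v‖ := by
  have h := hAR v
  rw [sub_eq_iff_eq_add', ← sub_eq_iff_eq_add] at h
  rw [graphNorm, ← h]
  have h1 := R.le_opNorm v
  have h2 := norm_sub_le (z • R v) v
  rw [norm_smul] at h2
  have h3 : ‖z‖ * ‖R v‖ ≤ ‖z‖ * (‖R‖ * ‖v‖) := by gcongr
  simp only
  linarith

/-- The estimates for the reduced problem which are used in the contraction argument. -/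
theorem exists_reducedMap_bounds {A : Op d} {W : Rd d → ℂ → ℂ} {ω₀ : ℂ} {φ₀ : A.domain}
    {δ α β τ : ℝ} {f : Rd d → ℂ → ℂ → ℂ} {g : ℂ → Rd d → ℂ} (hA : AssumptionA A) (hδ : 0 < δ)
    (hα : 0 < α) (hβ : 0 < β) (hτ : τ ≤ α * β) (hW : AssumptionW W ω₀ δ)
    (hf : AssumptionF A ω₀ φ₀ δ α β f g)
    {z : ℂ} {R : L2 d →L[ℂ] L2 d} (hR : ∀ v, R v ∈ A.domain)
    (hAR : ∀ v, z • R v - A ⟨R v, hR v⟩ = v) :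
    ∃ κ ρ₁ ε₁ : ℝ, 0 < κ ∧ 0 < ρ₁ ∧ 0 < ε₁ ∧ ∀ ε ∈ Ioo 0 ε₁,
      (∀ p : L2 d × ℂ, ‖p‖ ≤ ρ₁ → ‖p.2‖ < δ ∧
        graphNorm A (((ε ^ α : ℝ) : ℂ) • (φ₀ + ⟨R p.1, hR p.1⟩)) < δ) ∧
      (∀ ρ ≤ ρ₁, ∀ p q : L2 d × ℂ, ‖p‖ ≤ ρ → ‖q‖ ≤ ρ →
        ‖reducedMap W f ω₀ φ₀ α R ε p - reducedMap W f ω₀ φ₀ α R ε q‖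
          ≤ κ * (ρ + ε) * ‖p - q‖) ∧
      ‖reducedMap W f ω₀ φ₀ α R ε 0 - (ε : ℂ) • leadingTerm (g ω₀) α φ₀‖ ≤ κ * ε ^ (1 + τ) := by
  obtain ⟨κ, hκ, hlin⟩ := norm_linear_remainder_sub_le hδ hW φ₀ R
  obtain ⟨K, ε₁, hK, hε₁, hnl⟩ := hf.rescaled hA hδ hα hτ hβ
  set c := ‖R‖ + ‖z‖ * ‖R‖ + 1 with hc
  have hc0 : 0 < c := by positivity
  set ρ₁ := min (min 1 (δ / 4)) (δ / (2 * c)) with hρ₁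
  refine ⟨κ + K * (1 + ‖R‖), ρ₁, ε₁, by positivity, by positivity, hε₁, fun ε hε => ?_⟩
  obtain ⟨hsmall, hl, h0⟩ := hnl ε hε
  have hε0 := hε.1
  have hu : ∀ p : L2 d × ℂ, ‖p‖ ≤ ρ₁ → graphNorm A (φ₀ + ⟨R p.1, hR p.1⟩ - φ₀) < δ := by
    intro p hp
    rw [add_sub_cancel_left]
    refine (graphNorm_resolvent_le hR hAR p.1).trans_lt ?_
    have h1 : ‖p.1‖ ≤ δ / (2 * c) := (norm_fst_le p).trans (hp.trans (min_le_right _ _))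
    calc c * ‖p.1‖ ≤ c * (δ / (2 * c)) := by gcongr
      _ = δ / 2 := by field_simp
      _ < δ := by linarith
  have hμ : ∀ p : L2 d × ℂ, ‖p‖ ≤ ρ₁ → ‖p.2‖ < δ := fun p hp => by
    have : ‖p.2‖ ≤ δ / 4 := (norm_snd_le p).trans
      (hp.trans ((min_le_left _ _).trans (min_le_right _ _)))
    linarith
  refine ⟨fun p hp => ⟨hμ p hp, hsmall _ (hu p hp)⟩, fun ρ hρ p q hp hq => ?_, ?_⟩
  · have e1 := hlin ρ (hρ.trans (min_le_left _ _)) p q hp hq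
    have e2 := hl (ω₀ + p.2) (by simpa [dist_eq_norm] using hμ p (hp.trans hρ)) (ω₀ + q.2)
      (by simpa [dist_eq_norm] using hμ q (hq.trans hρ)) _ _ (hu p (hp.trans hρ))
      (hu q (hq.trans hρ))
    have e3 : ‖(ω₀ + p.2) - (ω₀ + q.2)‖ ≤ ‖p - q‖ := by
      rw [add_sub_add_left_eq_sub]; exact norm_snd_le (p - q)
    have e4 : ‖((φ₀ + ⟨R p.1, hR p.1⟩ : A.domain) : L2 d) - (φ₀ + ⟨R q.1, hR q.1⟩ : A.domain)‖
        ≤ ‖R‖ * ‖p - q‖ := by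
      have : ((φ₀ + ⟨R p.1, hR p.1⟩ : A.domain) : L2 d) - (φ₀ + ⟨R q.1, hR q.1⟩ : A.domain)
          = R (p.1 - q.1) := by
        simp
      rw [this]
      exact (R.le_opNorm _).trans (by gcongr; exact norm_fst_le (p - q))
    have hρ0 : 0 ≤ ρ := (norm_nonneg _).trans hp
    rw [reducedMap, reducedMap, add_sub_add_comm]
    calc _ ≤ _ := norm_add_le _ _
      _ ≤ κ * ρ * ‖p - q‖ + K * ε * (‖p - q‖ + ‖R‖ * ‖p - q‖) := by
        refine add_le_add e1 (e2.trans ?_)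
        gcongr
      _ ≤ (κ + K * (1 + ‖R‖)) * (ρ + ε) * ‖p - q‖ := by
        have h1 : 0 ≤ κ * ε * ‖p - q‖ := by positivity
        have h2 : 0 ≤ K * (1 + ‖R‖) * ρ * ‖p - q‖ := by positivity
        linarith
  · have e : reducedMap W f ω₀ φ₀ α R ε 0
        = ((ε ^ α : ℝ) : ℂ)⁻¹ • superposition f ω₀ (((ε ^ α : ℝ) : ℂ) • (φ₀ : L2 d)) := by
      simp [reducedMap]
    rw [e]
    refine h0.trans ?_
    gcongr
    nlinarith [norm_nonneg R]

/-- The reduced equation is equivalent to the original one. -/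
theorem reduced_eq_iff {A : Op d} {W : Rd d → ℂ → ℂ} {f : Rd d → ℂ → ℂ → ℂ} {ω₀ : ℂ}
    {φ₀ : A.domain} {α ε : ℝ} (hε : 0 < ε) {R : L2 d →L[ℂ] L2 d} (hR : ∀ v, R v ∈ A.domain)
    (h0 : A φ₀ - mulOp (fun x => W x ω₀) φ₀ = 0) (p : L2 d × ℂ)
    (hW : MemLp (fun x => W x (ω₀ + p.2)) ∞ volume)
    (hf : MemLp (fun x => f x (ω₀ + p.2)
      (((((ε ^ α : ℝ) : ℂ) • (φ₀ + ⟨R p.1, hR p.1⟩) : A.domain) : L2 d) x)) 2 volume) :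
    A ⟨R p.1, hR p.1⟩ - mulOp (fun x => W x ω₀) (R p.1)
        - p.2 • mulOp (fun x => deriv (W x) ω₀) φ₀ = reducedMap W f ω₀ φ₀ α R ε p ↔
      Solves A W f (ω₀ + p.2) (((ε ^ α : ℝ) : ℂ) • (φ₀ + ⟨R p.1, hR p.1⟩)) := by
  rw [solves_iff hW hf, reducedMap, LinearPMap.map_smul, LinearPMap.map_add]
  have hl : ((ε ^ α : ℝ) : ℂ) ≠ 0 := by exact_mod_cast (Real.rpow_pos_of_pos hε α).ne'
  set l := ((ε ^ α : ℝ) : ℂ)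
  have ec : ((l • (φ₀ + ⟨R p.1, hR p.1⟩) : A.domain) : L2 d) = l • ((φ₀ : L2 d) + R p.1) := rfl
  rw [ec, map_smul, ← smul_sub]
  set S := superposition f (ω₀ + p.2) (l • ((φ₀ : L2 d) + R p.1))
  have hS : ∀ X : L2 d, l • X = S ↔ X = l⁻¹ • S := fun X => by
    rw [eq_inv_smul_iff₀ hl]
  rw [hS, sub_eq_zero.1 h0]
  simp only [sub_apply, map_add]
  constructor
  · intro h
    rw [← sub_eq_zero] at h ⊢
    rw [← h]
    abel
  · intro h
    rw [← sub_eq_zero] at h ⊢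
    rw [← h]
    abel

theorem PT_reducedMap {A : Op d} {W : Rd d → ℂ → ℂ} {f : Rd d → ℂ → ℂ → ℂ} {g : ℂ → Rd d → ℂ}
    {ω₀ δ α ε : ℝ} {φ₀ : A.domain} (hδ : 0 < δ) (hW : AssumptionW W ω₀ δ)
    (hPT : PTSymmetricProblem A W f g ω₀ δ) (hφ₀ : PT (φ₀ : L2 d) = φ₀)
    {R : L2 d →L[ℂ] L2 d} (hR : ∀ v, R v ∈ A.domain) {p : L2 d × ℂ} (hp2 : ‖p.2‖ < δ)
    (hg : graphNorm A (((ε ^ α : ℝ) : ℂ) • (φ₀ + ⟨R p.1, hR p.1⟩)) < δ)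
    (hf : MemLp (fun x => f x (ω₀ + p.2)
      (((((ε ^ α : ℝ) : ℂ) • (φ₀ + ⟨R p.1, hR p.1⟩) : A.domain) : L2 d) x)) 2 volume)
    (hsym : PT (R p.1) = R p.1) (him : p.2.im = 0) :
    PT (reducedMap W f ω₀ φ₀ α R ε p) = reducedMap W f ω₀ φ₀ α R ε p := by
  obtain ⟨_, hm⟩ := hW.bounded
  obtain ⟨m, hm2⟩ : ∃ m : ℝ, p.2 = m := ⟨p.2.re, Complex.ext rfl (by simpa using him)⟩
  have hω : (ω₀ : ℂ) + p.2 = ((ω₀ + m : ℝ) : ℂ) := by rw [hm2]; push_cast; rfl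
  have hmδ : |m| < δ := by
    rw [hm2, Complex.norm_real] at hp2
    exact hp2
  have hmδ' : |ω₀ + m - ω₀| < δ := by rwa [add_sub_cancel_left]
  have hball : ((ω₀ + m : ℝ) : ℂ) ∈ Metric.ball (ω₀ : ℂ) δ := by
    rw [← hω, Metric.mem_ball, dist_eq_norm, add_sub_cancel_left]
    exact hp2
  have hsum : PT ((φ₀ : L2 d) + R p.1) = (φ₀ : L2 d) + R p.1 := by rw [PT_add, hφ₀, hsym]
  have h1 := PT_mulOp (hm _ hball).1 (hPT.potential _ hmδ') ((φ₀ : L2 d) + R p.1)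
  have h2 := PT_mulOp (hm _ (Metric.mem_ball_self hδ)).1 (hPT.potential ω₀ (by simpa using hδ))
    ((φ₀ : L2 d) + R p.1)
  have h3 := PT_mulOp_deriv hδ hW hPT (φ₀ : L2 d)
  rw [hω] at hf
  have h4 := PT_superposition hPT hmδ' hg hf
    (by rw [Submodule.coe_smul, PT_smul, Complex.conj_ofReal, Submodule.coe_add]; rw [hsum])
  have h4 : PT (superposition f ((ω₀ + m : ℝ) : ℂ) (((ε ^ α : ℝ) : ℂ) • ((φ₀ : L2 d) + R p.1)))
    = superposition f ((ω₀ + m : ℝ) : ℂ) (((ε ^ α : ℝ) : ℂ) • ((φ₀ : L2 d) + R p.1)) := h4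
  rw [hsum] at h1 h2
  rw [hφ₀] at h3
  rw [reducedMap, hω, hm2, PT_add, PT_sub, PT_smul, PT_smul, h3, h4, sub_apply, PT_sub, h1, h2,
    map_inv₀, Complex.conj_ofReal, Complex.conj_ofReal]

/-- The branch of solutions, in the coordinates `φ = ε^α (φ₀ + R v)`, `ω = ω₀ + μ`. -/
theorem exists_solution_branch {A : Op d} {W : Rd d → ℂ → ℂ} {f : Rd d → ℂ → ℂ → ℂ}
    {g : ℂ → Rd d → ℂ} {ω₀ : ℝ} {φ₀ : A.domain} {φs : L2 d} {δ α β τ : ℝ} (hδ : 0 < δ)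
    (hα : 0 < α) (hβ : 0 < β) (hτ : 0 < τ) (hτ' : τ ≤ min 1 (α * β)) (hA : AssumptionA A)
    (hW : AssumptionW W ω₀ δ) (hsimple : AlgebraicallySimple A W ω₀ φ₀) (hisol : Isolated A W ω₀)
    (hnorm : Normalized A W ω₀ φ₀ φs) (hWt : Transversal W ω₀ φ₀ φs)
    (hf : AssumptionF A ω₀ φ₀ δ α β f g) (hPT : PTSymmetricProblem A W f g ω₀ δ)
    (hφ₀ : PT (φ₀ : L2 d) = φ₀) {z : ℂ} {R : L2 d →L[ℂ] L2 d} (hR : ∀ v, R v ∈ A.domain)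
    (hAR : ∀ v, z • R v - A ⟨R v, hR v⟩ = v)
    (hRA : ∀ u : A.domain, R (z • (u : L2 d) - A u) = u) :
    ∃ ρ C ε₀ : ℝ, 0 < ρ ∧ 0 < C ∧ 0 < ε₀ ∧ ∃ q₀ : L2 d × ℂ, inner ℂ φs (R q₀.1) = 0 ∧
      ∀ ε ∈ Ioo 0 ε₀, ∃ p : L2 d × ℂ, (PT (R p.1) = R p.1 ∧ p.2.im = 0) ∧ ‖p‖ ≤ C * ε ∧
        (Solves A W f (ω₀ + p.2) (((ε ^ α : ℝ) : ℂ) • (φ₀ + ⟨R p.1, hR p.1⟩)) ∧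
          inner ℂ φs (R p.1) = 0) ∧
        (∀ q : L2 d × ℂ, ‖q‖ ≤ ρ →
          Solves A W f (ω₀ + q.2) (((ε ^ α : ℝ) : ℂ) • (φ₀ + ⟨R q.1, hR q.1⟩)) ∧
            inner ℂ φs (R q.1) = 0 → q = p) ∧
        ‖p - (ε : ℂ) • q₀‖ ≤ C * ε ^ (1 + τ) := by
  obtain ⟨Λ, hΛ⟩ :=
    exists_bordered_equiv hδ hA hW hsimple hisol hnorm hWt hR hAR hRA
  obtain ⟨κ, ρ₁, ε₁, hκ, hρ₁, hε₁, hbd⟩ := exists_reducedMap_bounds hA hδ hα hβ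
    (hτ'.trans (min_le_right _ _)) hW hf hR hAR
  have h0 : A φ₀ - mulOp (fun x => W x ω₀) φ₀ = 0 := (hsimple.ker φ₀).2 ⟨1, by simp⟩
  obtain ⟨_, hWm⟩ := hW.bounded
  have hball : ∀ p : L2 d × ℂ, ‖p.2‖ < δ → (ω₀ : ℂ) + p.2 ∈ Metric.ball (ω₀ : ℂ) δ := by
    intro p hp
    rwa [Metric.mem_ball, dist_eq_norm, add_sub_cancel_left]
  have hΛs : ∀ (p : L2 d × ℂ) y, Λ.symm (y, 0) = p ↔
      (A ⟨R p.1, hR p.1⟩ - mulOp (fun x => W x ω₀) (R p.1)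
        - p.2 • mulOp (fun x => deriv (W x) ω₀) φ₀ = y ∧ inner ℂ φs (R p.1) = 0) := by
    intro p y
    rw [ContinuousLinearEquiv.symm_apply_eq, eq_comm, hΛ p.1 p.2, Prod.mk.injEq]
  have hfix : ∀ ε ∈ Ioo 0 ε₁, ∀ p : L2 d × ℂ, ‖p‖ ≤ ρ₁ → (Λ.symm (reducedMap W f ω₀ φ₀ α R ε p, 0) = p ↔
      Solves A W f (ω₀ + p.2) (((ε ^ α : ℝ) : ℂ) • (φ₀ + ⟨R p.1, hR p.1⟩)) ∧
        inner ℂ φs (R p.1) = 0) := by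
    intro ε hε p hp
    obtain ⟨h1, h2⟩ := (hbd ε hε).1 p hp
    rw [hΛs, reduced_eq_iff hε.1 hR h0 p (hWm _ (hball p h1)).1
      (hf.memL2 _ (hball p h1) _ h2)]
  -- Symmetry is imposed on `R v` and not on `v`: the resolvent point `z` may be non-real, and then
  -- `R` need not commute with `ℬ`.
  let S : Set (L2 d × ℂ) := {p | PT (R p.1) = R p.1 ∧ p.2.im = 0}
  have hS : IsClosed S := by
    refine IsClosed.inter (isClosed_eq ?_ ?_) (isClosed_eq ?_ continuous_const)
    · exact continuous_PT.comp (R.continuous.comp continuous_fst)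
    · exact R.continuous.comp continuous_fst
    · exact Complex.continuous_im.comp continuous_snd
  have hsymm : ∀ y y' : L2 d,
      ‖Λ.symm (y, 0) - Λ.symm (y', 0)‖ ≤
        ‖(Λ.symm : L2 d × ℂ →L[ℂ] L2 d × ℂ)‖ * ‖y - y'‖ := by
    intro y y'
    rw [← map_sub]
    refine ((Λ.symm : L2 d × ℂ →L[ℂ] L2 d × ℂ).le_opNorm _).trans (le_of_eq ?_)
    simp [Prod.norm_def]
  obtain ⟨ρ, hρ, hρρ₁, C, hC, ε₀, hε₀, hε₀ε₁, hbranch⟩ := exists_fixedPoint_branch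
    (fun ε p => Λ.symm (reducedMap W f ω₀ φ₀ α R ε p, 0)) (Λ.symm (leadingTerm (g ω₀) α φ₀, 0)) hS ⟨by simp [PT_zero], rfl⟩
    (κ := (‖(Λ.symm : L2 d × ℂ →L[ℂ] L2 d × ℂ)‖ + 1) * κ) (by positivity) hρ₁ hε₁ hτ
    (hτ'.trans (min_le_left _ _))
    (fun ε hε p hpS hp => by
      obtain ⟨h1, h2⟩ := (hbd ε hε).1 p hp
      have hy := PT_reducedMap hδ hW hPT hφ₀ hR h1 h2 (hf.memL2 _ (hball p h1) _ h2)
        hpS.1 hpS.2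
      obtain ⟨e1, e2⟩ := (hΛs (Λ.symm (reducedMap W f ω₀ φ₀ α R ε p, 0)) (reducedMap W f ω₀ φ₀ α R ε p)).1 rfl
      exact symmetric_of_bordered hδ hA hW hsimple hisol hnorm hWt hPT hφ₀ hy
        (u := ⟨R (Λ.symm (reducedMap W f ω₀ φ₀ α R ε p, 0)).1, hR _⟩) e1 e2)
    (fun ε hε s hs p q hp hq => by
      refine (hsymm _ _).trans ?_
      have h1 := (hbd ε hε).2.1 s hs p q hp hq
      rw [mul_assoc, mul_assoc, ← mul_assoc κ]
      gcongr
      linarith)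
    (fun ε hε => by
      have h1 := (hbd ε hε).2.2
      have h2 : (ε : ℂ) • Λ.symm (leadingTerm (g ω₀) α φ₀, 0) = Λ.symm ((ε : ℂ) • leadingTerm (g ω₀) α φ₀, 0) := by
        rw [← map_smul]; simp
      rw [h2, mul_assoc]
      refine (hsymm _ _).trans ?_
      gcongr
      linarith)
  refine ⟨ρ, C, ε₀, hρ, hC, hε₀, Λ.symm (leadingTerm (g ω₀) α φ₀, 0), ((hΛs _ _).1 rfl).2,
    fun ε hε => ?_⟩
  obtain ⟨p, hpS, hpC, hpρ, hpfix, hpuniq, hpG⟩ := hbranch ε hε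
  have hε' : ε ∈ Ioo 0 ε₁ := ⟨hε.1, hε.2.trans_le hε₀ε₁⟩
  exact ⟨p, hpS, hpC, (hfix ε hε' p (hpρ.trans hρρ₁)).1 hpfix, fun q hq hsol =>
    hpuniq q hq ((hfix ε hε' q (hq.trans hρρ₁)).2 hsol), hpG⟩

end PTBif

end

/-! ### The branch in the original variables -/

theorem proposition2 (d : ℕ) (hd : 1 ≤ d)
    (A : PTBif.Op d) (W : PTBif.Rd d → ℂ → ℂ)
    (f : PTBif.Rd d → ℂ → ℂ → ℂ) (g : ℂ → PTBif.Rd d → ℂ)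
    (ω₀ : ℝ) (φ₀ : A.domain) (φs : PTBif.L2 d)
    (δ α β τ : ℝ) (hδ : 0 < δ) (hα : 0 < α) (hβ : 0 < β)
    (hτ : 0 < τ) (hτ' : τ ≤ min 1 (α * β))
    (hA : PTBif.AssumptionA A)
    (hW : PTBif.AssumptionW W ω₀ δ)
    (hsimple : PTBif.AlgebraicallySimple A W ω₀ φ₀)
    (hisol : PTBif.Isolated A W ω₀)
    (hnorm : PTBif.Normalized A W ω₀ φ₀ φs)
    (hWt : PTBif.Transversal W ω₀ φ₀ φs)
    (hf : PTBif.AssumptionF A ω₀ φ₀ δ α β f g)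
    (hPT : PTBif.PTSymmetricProblem A W f g ω₀ δ) :
    -- the normalized eigenfunction can be chosen symmetric
    (∃ c : ℂ, ‖c‖ = 1 ∧ PTBif.PT (c • (φ₀ : PTBif.L2 d)) = c • (φ₀ : PTBif.L2 d)) ∧
    -- and for such a choice the bifurcating branch is real and symmetric
    (PTBif.PT (φ₀ : PTBif.L2 d) = φ₀ →
      ∃ ε₀ η r : ℝ, 0 < ε₀ ∧ 0 < η ∧ 0 < r ∧ ∃ (ν : ℂ) (ϕ : A.domain),
        inner ℂ φs (ϕ : PTBif.L2 d) = 0 ∧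
        ∀ ε ∈ Set.Ioo 0 ε₀, ∃ (ω : ℂ) (φ : A.domain),
          -- the unique solution near the bifurcation point
          PTBif.LocalSolution A W f ω₀ φ₀ φs α η ε ω φ ∧
          (∀ (ω' : ℂ) (φ' : A.domain),
            PTBif.LocalSolution A W f ω₀ φ₀ φs α η ε ω' φ' → ω' = ω ∧ φ' = φ) ∧
          -- its expansion
          (∃ (σ : ℂ) (ψ : A.domain),
            ‖σ‖ ≤ r ∧ PTBif.graphNorm A ψ ≤ r ∧ inner ℂ φs (ψ : PTBif.L2 d) = 0 ∧
            ω = ω₀ + (ε : ℂ) * ν + ((ε ^ (1 + τ) : ℝ) : ℂ) * σ ∧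
            φ = ((ε ^ α : ℝ) : ℂ) • φ₀ + ((ε ^ (α + 1) : ℝ) : ℂ) • ϕ
              + ((ε ^ (α + 1 + τ) : ℝ) : ℂ) • ψ) ∧
          -- reality and symmetry
          ω.im = 0 ∧ PTBif.PT (φ : PTBif.L2 d) = φ) := by
  refine ⟨PTBif.exists_phase_PT_eq hδ hW hPT hsimple hnorm.norm_one, fun hφ₀ => ?_⟩
  obtain ⟨z, R, hR, hRA⟩ := hA.resolvent
  choose hR hAR using hR
  obtain ⟨ρ, C, ε₀, hρ, hC, hε₀, q₀, hq₀s, hbranch⟩ := PTBif.exists_solution_branch hδ hα hβ hτ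
    hτ' hA hW hsimple hisol hnorm hWt hf hPT hφ₀ hR hAR hRA
  set c := ‖R‖ + ‖z‖ * ‖R‖ + 1 with hc
  have hc1 : 1 ≤ c := by
    have : 0 ≤ ‖R‖ + ‖z‖ * ‖R‖ := by positivity
    linarith
  have hc0 : 0 < c := by linarith
  have hcR : ∀ v, PTBif.graphNorm A ⟨R v, hR v⟩ ≤ c * ‖v‖ := PTBif.graphNorm_resolvent_le hR hAR
  -- The inverse of the parametrization is `v = z u - A u`, of norm at most `(‖z‖ + 1) ‖u‖_A`; this
  -- `η` puts every local solution into the uniqueness ball of radius `ρ`.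
  set η := ρ / (‖z‖ + 1) with hη
  have hη0 : 0 < η := by positivity
  have hηρ : (‖z‖ + 1) * η = ρ := by rw [hη]; field_simp
  have hηρ' : η ≤ ρ := by nlinarith [norm_nonneg z]
  -- The branch is `O(ε)` with constant `c C` in graph norm, so `ε < η / (c C)` keeps it strictly
  -- inside the `η`-neighbourhood.
  refine ⟨min ε₀ (η / (c * C)), η, c * C, by positivity, hη0, by positivity, q₀.2,
    ⟨R q₀.1, hR q₀.1⟩, hq₀s, fun ε hε => ?_⟩
  have hεε₀ : ε ∈ Set.Ioo 0 ε₀ := ⟨hε.1, hε.2.trans_le (min_le_left _ _)⟩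
  have hε0 := hε.1
  have hcCε : c * C * ε < η := by
    have := hε.2.trans_le (min_le_right _ _)
    rwa [lt_div_iff₀ (by positivity), mul_comm] at this
  obtain ⟨p, ⟨hpsym, hpim⟩, hpC, ⟨hpsol, hps⟩, hpuniq, hpG⟩ := hbranch ε hεε₀
  have hl0 : 0 < ε ^ α := Real.rpow_pos_of_pos hε0 α
  have hlne : ((ε ^ α : ℝ) : ℂ) ≠ 0 := by exact_mod_cast hl0.ne'
  have hln : ‖((ε ^ α : ℝ) : ℂ)‖ = ε ^ α := by
    rw [Complex.norm_real, Real.norm_of_nonneg hl0.le]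
  have hloc : PTBif.LocalSolution A W f ω₀ φ₀ φs α η ε (ω₀ + p.2)
      (((ε ^ α : ℝ) : ℂ) • (φ₀ + ⟨R p.1, hR p.1⟩)) := by
    refine ⟨hpsol, ?_, ?_, ?_⟩
    · rw [Submodule.coe_smul, Submodule.coe_add, inner_smul_right, inner_add_right, hnorm.inner_one,
        hps, add_zero, mul_one]
    · rw [add_sub_cancel_left]
      calc ‖p.2‖ ≤ C * ε := (norm_snd_le p).trans hpC
        _ ≤ c * C * ε := by
          rw [mul_assoc]
          exact le_mul_of_one_le_left (by positivity) hc1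
        _ < η := hcCε
    · rw [smul_add, add_sub_cancel_left, PTBif.graphNorm_smul, hln, mul_comm]
      gcongr
      calc _ ≤ c * ‖p.1‖ := hcR p.1
        _ ≤ c * (C * ε) := by gcongr; exact (norm_fst_le p).trans hpC
        _ < η := by rwa [← mul_assoc]
  refine ⟨ω₀ + p.2, ((ε ^ α : ℝ) : ℂ) • (φ₀ + ⟨R p.1, hR p.1⟩), hloc, ?_, ?_, ?_, ?_⟩
  · intro ω' φ' hsol
    set u : A.domain := ((ε ^ α : ℝ) : ℂ)⁻¹ • φ' - φ₀ with hu
    have hφ' : φ' = ((ε ^ α : ℝ) : ℂ) • (φ₀ + u) := by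
      rw [hu, add_sub_cancel, smul_inv_smul₀ hlne]
    have hun : PTBif.graphNorm A u < η := by
      have h1 := hsol.near_phi
      rw [hφ', smul_add, add_sub_cancel_left, PTBif.graphNorm_smul, hln, mul_comm] at h1
      exact lt_of_mul_lt_mul_right h1 hl0.le
    set q : PTBif.L2 d × ℂ := (z • (u : PTBif.L2 d) - A u, ω' - ω₀) with hq
    have hqu : (⟨R q.1, hR q.1⟩ : A.domain) = u := Subtype.ext (hRA u)
    have hqρ : ‖q‖ ≤ ρ := by
      rw [Prod.norm_def]
      refine max_le ?_ (hsol.near_omega.le.trans hηρ')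
      calc ‖z • (u : PTBif.L2 d) - A u‖ ≤ ‖z‖ * ‖(u : PTBif.L2 d)‖ + ‖A u‖ := by
            rw [← norm_smul]; exact norm_sub_le _ _
        _ ≤ (‖z‖ + 1) * PTBif.graphNorm A u := by
            rw [PTBif.graphNorm]
            nlinarith [norm_nonneg z, norm_nonneg (A u), norm_nonneg (u : PTBif.L2 d),
              mul_nonneg (norm_nonneg z) (norm_nonneg (A u))]
        _ ≤ (‖z‖ + 1) * η := by gcongr
        _ = ρ := hηρ
    have hqp := hpuniq q hqρ (by
      have hω : (ω₀ : ℂ) + q.2 = ω' := by rw [hq]; ring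
      rw [hqu, ← hφ', hω]
      refine ⟨hsol.solves, ?_⟩
      have h1 := hsol.constraint
      have h2 : R q.1 = u := hRA u
      rw [hφ', Submodule.coe_smul, Submodule.coe_add, inner_smul_right, inner_add_right,
        hnorm.inner_one] at h1
      have h3 := mul_left_cancel₀ hlne (h1.trans (mul_one _).symm)
      rw [h2]
      simpa using h3)
    rw [← hqp, hqu]
    exact ⟨by rw [hq]; ring, hφ'⟩
  · have he0 : 0 < ε ^ (1 + τ) := Real.rpow_pos_of_pos hε0 _
    have hene : ((ε ^ (1 + τ) : ℝ) : ℂ) ≠ 0 := by exact_mod_cast he0.ne'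
    -- The rescaled remainder is bounded by `C`; its two components give `ψ = R q.1` and `σ = q.2`.
    set q : PTBif.L2 d × ℂ := ((ε ^ (1 + τ) : ℝ) : ℂ)⁻¹ • (p - (ε : ℂ) • q₀) with hq
    have hpq : p = (ε : ℂ) • q₀ + ((ε ^ (1 + τ) : ℝ) : ℂ) • q := by
      rw [hq, smul_inv_smul₀ hene, add_sub_cancel]
    have hqC : ‖q‖ ≤ C := by
      rw [hq, norm_smul, norm_inv, Complex.norm_real, Real.norm_of_nonneg he0.le,
        inv_mul_le_iff₀ he0, mul_comm]
      exact hpG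
    have hp1 : R p.1 = (ε : ℂ) • R q₀.1 + ((ε ^ (1 + τ) : ℝ) : ℂ) • R q.1 := by
      conv_lhs => rw [hpq]
      rw [Prod.fst_add, Prod.smul_fst, Prod.smul_fst, map_add, map_smul, map_smul]
    refine ⟨q.2, ⟨R q.1, hR q.1⟩, ?_, ?_, ?_, ?_, ?_⟩
    · exact ((norm_snd_le q).trans hqC).trans (le_mul_of_one_le_left hC.le hc1)
    · exact (hcR q.1).trans (by gcongr; exact (norm_fst_le q).trans hqC)
    · rw [hp1, inner_add_right, inner_smul_right, inner_smul_right, hq₀s, mul_zero, zero_add] at hps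
      exact (mul_eq_zero.1 hps).resolve_left hene
    · conv_lhs => rw [hpq]
      rw [Prod.snd_add, Prod.smul_snd, Prod.smul_snd, smul_eq_mul, smul_eq_mul, add_assoc]
    · apply Subtype.ext
      have e1 : ε ^ (α + 1) = ε ^ α * ε := by rw [Real.rpow_add hε0, Real.rpow_one]
      have e2 : ε ^ (α + 1 + τ) = ε ^ α * ε ^ (1 + τ) := by rw [add_assoc, Real.rpow_add hε0]
      simp only [Submodule.coe_smul, Submodule.coe_add, hp1, e1, e2, Complex.ofReal_mul]
      module
  · rw [Complex.add_im, hpim, Complex.ofReal_im, add_zero]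
  · rw [Submodule.coe_smul, Submodule.coe_add, PTBif.PT_smul, Complex.conj_ofReal, PTBif.PT_add,
      hφ₀]
    congr 2
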